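/- **Setting.** A base station with $M$ antennas serves $K$ users; user $k$ has $N_k$ receive antennas and $D_k$ data streams, channel matrix $\mathbf H_k\in\mathbb C^{N_k\times M}$, noise variance $\sigma_k^2>0$ and weight $\alpha_k\ge 0$; antenna $m$ has power budget $P_m\ge 0$. Precoders are $\mathbf P=\{\mathbf P_k\}_{k=1}^K$ with $\mathbf P_k\in\mathbb C^{M\times D_k}$; per-antenna power constraints (PAPCs): $\sum_k[\mathbf P_k\mathbf P_k^H]_{m,m}\le P_m$ for all $m$. Put $\mathbf N_k=\sum_{j\ne k}\mathbf H_k\mathbf P_j\mathbf P_j^H\mathbf H_k^H+\sigma_k^2\mathbf I$, $R_k=\log\det(\mathbf I+\mathbf H_k\mathbf P_k\mathbf P_k^H\mathbf H_k^H\mathbf N_k^{-1})$ and, for $\mathbf U_k\in\mathbb C^{N_k\times D_k}$, $$\mathbf E_k=(\mathbf I-\mathbf U_k^H\mathbf H_k\mathbf P_k)(\mathbf I-\mathbf U_k^H\mathbf H_k\mathbf P_k)^H+\mathbf U_k^H\mathbf N_k\mathbf U_k .$$ The *WSR problem* is to maximize $\sum_k\alpha_kR_k$ over $\mathbf P$ subject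 to the PAPCs. The *weighted sum-MSE problem* is to minimize $\sum_k\alpha_k(\operatorname{Tr}(\mathbf W_k\mathbf E_k)-\log\det\mathbf W_k)$ over $(\mathbf U,\mathbf W,\mathbf P)$, with $\mathbf U=\{\mathbf U_k\}$ free, $\mathbf W=\{\mathbf W_k\}$ consisting of positive definite matrices $\mathbf W_k\in\mathbb C^{D_k\times D_k}$, and $\mathbf P$ subject to the PAPCs. A stationary point of the minimization (maximization) of $f$ over a convex set $\mathcal S$ is a point $x\in\mathcal S$ at which $f$ is real-differentiable with $Df(x)[y-x]\ge 0$ (respectively $\le 0$) for all $y\in\mathcal S$. **PAPC-WMMSE.** Write $\mathbf P=[\mathbf P_1,\dots,\mathbf P_K]=(\mathbf p_1,\dots,\mathbf p_M)^H$, and let $\mathbf h_m$ be the $m$-th column of $[\mathbf H_1^T,\dots,\mathbf H_K^T]^T$. Start from any $\mathbf P$ satisfying the PAPCs and $\mathbf W_k=\mathbf I$. Each iteration (repeated indefinitely, without stopping) sets, for all $k$, $$\mathbf U_k=\Big(\sum_j\mathbf H_k\mathbf P_j\mathbf P_j^H\mathbf H_k^H+\sigma_k^2\mathbf I\Big)^{-1}\mathbf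 H_k\mathbf P_k,\qquad \mathbf W_k=(\mathbf I-\mathbf U_k^H\mathbf H_k\mathbf P_k)^{-1},$$ then, with $\mathbf A=\operatorname{blkdiag}(\alpha_k\mathbf U_k\mathbf W_k\mathbf U_k^H)_k$, $\mathbf B=\operatorname{blkdiag}(\alpha_k\mathbf W_k\mathbf U_k^H)_k$ and $\mathbf C=\sum_l\mathbf p_l\mathbf h_l^H$, carries out successively for $m=1,\dots,M$ $$\mathbf C\leftarrow\mathbf C-\mathbf p_m\mathbf h_m^H,\quad \mathbf b_m=-\mathbf B\mathbf h_m+\mathbf C\mathbf A\mathbf h_m,\quad \mathbf p_m\leftarrow-\mathbf b_m\min\Big(\frac1{\mathbf h_m^H\mathbf A\mathbf h_m},\frac{\sqrt{P_m}}{\|\mathbf b_m\|_2}\Big),\quad \mathbf C\leftarrow\mathbf C+\mathbf p_m\mathbf h_m^H,$$ where $\mathbf p_m\leftarrow\mathbf 0$ if $\mathbf b_m=\mathbf 0$ (which is always so if $\mathbf h_m^H\mathbf A\mathbf h_m=0$). **Theorem.** Every limit point $(\mathbf U^\star,\mathbf W^\star,\mathbf P^\star)$ of the sequence of iterates $(\mathbf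 U,\mathbf W,\mathbf P)$ generated by PAPC-WMMSE is a stationary point of the weighted sum-MSE problem, and the corresponding $\mathbf P^\star$ is a stationary point of the WSR problem with per-antenna power constraints. -/

import Mathlib

open scoped Matrix

noncomputable section

namespace PAPC

/-- First-order stationarity of `x` for the problem of minimizing `f` over a convex set `S`:
`x` is feasible, `f` is (real) differentiable at `x`, and the derivative of `f` at `x` is
nonnegative in every feasible direction `y - x`, `y ∈ S`. -/
def IsStationaryMin {E : Type*} [AddCommGroup E] [Module ℝ E] [TopologicalSpace E]
    (f : E → ℝ) (S : Set E) (x : E) : Prop :=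
  x ∈ S ∧ ∃ f' : E →L[ℝ] ℝ, HasFDerivAt f f' x ∧ ∀ y ∈ S, 0 ≤ f' (y - x)

/-- First-order stationarity for the problem of maximizing `f` over a convex set `S`. -/
def IsStationaryMax {E : Type*} [AddCommGroup E] [Module ℝ E] [TopologicalSpace E]
    (f : E → ℝ) (S : Set E) (x : E) : Prop :=
  x ∈ S ∧ ∃ f' : E →L[ℝ] ℝ, HasFDerivAt f f' x ∧ ∀ y ∈ S, f' (y - x) ≤ 0

/-- The data of a multi-user MIMO downlink with `M` base station antennas and `K` users; user `k`
has `N k` receive antennas and `D k` data streams. -/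
structure System (M K : ℕ) (N D : Fin K → ℕ) where
  /-- the channel matrices `H_k` -/
  H : ∀ k, Matrix (Fin (N k)) (Fin M) ℂ
  /-- the noise standard deviations `σ_k` -/
  σ : Fin K → ℝ
  /-- the user priorities (weights) `α_k` -/
  α : Fin K → ℝ
  /-- the per-antenna power budgets `P_m` -/
  Pow : Fin M → ℝ
  σ_pos : ∀ k, 0 < σ k
  α_nonneg : ∀ k, 0 ≤ α k
  Pow_nonneg : ∀ m, 0 ≤ Pow m

/-- Families of precoders `P_k`, of size `M × D_k`. -/
abbrev Precoders (M K : ℕ) (D : Fin K → ℕ) : Type :=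
  ∀ k : Fin K, Matrix (Fin M) (Fin (D k)) ℂ

/-- Families of receivers `U_k`, of size `N_k × D_k`. -/
abbrev Receivers (K : ℕ) (N D : Fin K → ℕ) : Type :=
  ∀ k : Fin K, Matrix (Fin (N k)) (Fin (D k)) ℂ

/-- Families of weight matrices `W_k`, of size `D_k × D_k`. -/
abbrev Weights (K : ℕ) (D : Fin K → ℕ) : Type :=
  ∀ k : Fin K, Matrix (Fin (D k)) (Fin (D k)) ℂ

/-- Triples `(U, W, P)`. -/
abbrev Point (M K : ℕ) (N D : Fin K → ℕ) : Type :=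
  Receivers K N D × Weights K D × Precoders M K D

namespace System

variable {M K : ℕ} {N D : Fin K → ℕ} (S : System M K N D)

/-! ### The two optimization problems -/

/-- Precoders that obey the per-antenna power constraints
`∑ k, [P_k P_kᴴ]_{m,m} ≤ P_m` for all `m`. -/
def feasibleP : Set (Precoders M K D) :=
  {P | ∀ m, (∑ k, (P k * (P k)ᴴ) m m).re ≤ S.Pow m}

/-- Interference plus noise covariance `∑_{j ≠ k} H_k P_j P_jᴴ H_kᴴ + σ_k² I` of user `k`. -/
def interf (P : Precoders M K D) (k : Fin K) : Matrix (Fin (N k)) (Fin (N k)) ℂ :=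
  ∑ j ∈ Finset.univ.erase k, S.H k * P j * (P j)ᴴ * (S.H k)ᴴ
    + ((S.σ k : ℂ) ^ 2) • (1 : Matrix (Fin (N k)) (Fin (N k)) ℂ)

/-- Received covariance `∑_j H_k P_j P_jᴴ H_kᴴ + σ_k² I` of user `k`. -/
def recvCov (P : Precoders M K D) (k : Fin K) : Matrix (Fin (N k)) (Fin (N k)) ℂ :=
  ∑ j, S.H k * P j * (P j)ᴴ * (S.H k)ᴴ
    + ((S.σ k : ℂ) ^ 2) • (1 : Matrix (Fin (N k)) (Fin (N k)) ℂ)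

/-- The achievable rate `R_k = log det (I + H_k P_k P_kᴴ H_kᴴ (interference plus noise)⁻¹)`. The
determinant is a positive real number. -/
def rate (P : Precoders M K D) (k : Fin K) : ℝ :=
  Real.log
    (1 + S.H k * P k * (P k)ᴴ * (S.H k)ᴴ * (S.interf P k)⁻¹ :
      Matrix (Fin (N k)) (Fin (N k)) ℂ).det.re

/-- The weighted sum-rate. -/
def wsr (P : Precoders M K D) : ℝ := ∑ k, S.α k * S.rate P k

/-- The MSE matrix `E_k`. -/
def mse (U : Receivers K N D) (P : Precoders M K D) (k : Fin K) :
    Matrix (Fin (D k)) (Fin (D k)) ℂ :=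
  (1 - (U k)ᴴ * S.H k * P k) * (1 - (U k)ᴴ * S.H k * P k)ᴴ + (U k)ᴴ * S.interf P k * U k

/-- The weighted sum-MSE objective `∑ k, α_k (Tr (W_k E_k) - log det W_k)`. The trace and the
determinant are real for Hermitian `W_k`. -/
def wmmse (x : Point M K N D) : ℝ :=
  ∑ k, S.α k *
    ((x.2.1 k * S.mse x.1 x.2.2 k).trace.re - Real.log (x.2.1 k).det.re)

open scoped ComplexOrder in
/-- The feasible set of the weighted sum-MSE problem: `U` is free, every `W_k` is (Hermitian)
positive definite, and `P` obeys the per-antenna power constraints. -/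
def feasible : Set (Point M K N D) :=
  {x | (∀ k, (x.2.1 k).PosDef) ∧ x.2.2 ∈ S.feasibleP}

/-! ### The algorithm -/

/-- Receiver update `U_k = (∑_j H_k P_j P_jᴴ H_kᴴ + σ_k² I)⁻¹ H_k P_k`. -/
def updateU (P : Precoders M K D) : Receivers K N D :=
  fun k => (S.recvCov P k)⁻¹ * (S.H k * P k)

/-- Weight update `W_k = (I - U_kᴴ H_k P_k)⁻¹`. -/
def updateW (U : Receivers K N D) (P : Precoders M K D) : Weights K D :=
  fun k => (1 - (U k)ᴴ * S.H k * P k)⁻¹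

/-- The vector `p_m`, i.e. the `m`-th column of `Pᴴ`, where `P = [P_1, …, P_K]`. -/
def row (P : Precoders M K D) (m : Fin M) : (Σ k, Fin (D k)) → ℂ :=
  fun d => star (P d.1 m d.2)

/-- The precoders whose vectors `p_m` are given: `P = (p_1, …, p_M)ᴴ`. -/
def ofRows (p : Fin M → (Σ k, Fin (D k)) → ℂ) : Precoders M K D :=
  fun k => Matrix.of fun m d => star (p m ⟨k, d⟩)

/-- The vector `h_m`, i.e. the `m`-th column of the stacked channel `H = [H_1; …; H_K]`. -/
def col (m : Fin M) : (Σ k, Fin (N k)) → ℂ :=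
  fun i => S.H i.1 i.2 m

/-- `A = blkdiag (α_k U_k W_k U_kᴴ)`. -/
def matA (U : Receivers K N D) (W : Weights K D) :
    Matrix (Σ k, Fin (N k)) (Σ k, Fin (N k)) ℂ :=
  Matrix.blockDiagonal' fun k => (S.α k : ℂ) • (U k * W k * (U k)ᴴ)

/-- `B = blkdiag (α_k W_k U_kᴴ)`. -/
def matB (U : Receivers K N D) (W : Weights K D) :
    Matrix (Σ k, Fin (D k)) (Σ k, Fin (N k)) ℂ :=
  Matrix.blockDiagonal' fun k => (S.α k : ℂ) • (W k * (U k)ᴴ)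

/-- `a_m = h_mᴴ A h_m`, a nonnegative real number. -/
def scalA (A : Matrix (Σ k, Fin (N k)) (Σ k, Fin (N k)) ℂ) (m : Fin M) : ℝ :=
  (star (S.col m) ⬝ᵥ (A *ᵥ S.col m)).re

/-- The state of the loop over the antennas: the current vectors `p_1, …, p_M` and the matrix
`C`. -/
abbrev LoopState (M K : ℕ) (N D : Fin K → ℕ) : Type :=
  (Fin M → (Σ k, Fin (D k)) → ℂ) × Matrix (Σ k, Fin (D k)) (Σ k, Fin (N k)) ℂ

/-- One pass of the loop over the antennas, for antenna `m`:
`C ← C - p_m h_mᴴ`, `b_m ← -B h_m + C A h_m`, `p_m ← -b_m min (1 / a_m, √P_m / ‖b_m‖₂)`,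
`C ← C + p_m h_mᴴ`.
If `a_m = 0`, then `b_m = 0` and the subproblem for `p_m` has a constant objective; the formula is
then read as `p_m ← 0`. It also gives `p_m ← 0` if `b_m = 0 < a_m`, as it should. -/
def antennaStep (U : Receivers K N D) (W : Weights K D) (m : Fin M)
    (s : LoopState M K N D) : LoopState M K N D :=
  let A := S.matA U W
  let B := S.matB U W
  let h := S.col m
  let a := S.scalA A m
  let C₀ := s.2 - Matrix.vecMulVec (s.1 m) (star h)
  let b := -(B *ᵥ h) + C₀ *ᵥ (A *ᵥ h)
  let p := -((min (1 / a) (√(S.Pow m) / ‖WithLp.toLp 2 b‖) : ℝ) : ℂ) • b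
  (Function.update s.1 m p, C₀ + Matrix.vecMulVec p (star h))

/-- The loop over the antennas after its first `m` passes (all of them if `M ≤ m`); it starts
with `C = ∑_l p_l h_lᴴ`. -/
def antennaLoop (U : Receivers K N D) (W : Weights K D) (P : Precoders M K D) :
    ℕ → LoopState M K N D
  | 0 => (row P, ∑ l, Matrix.vecMulVec (row P l) (star (S.col l)))
  | m + 1 =>
    if h : m < M then S.antennaStep U W ⟨m, h⟩ (antennaLoop U W P m)
    else antennaLoop U W P m

/-- The update of all the rows of `P`, one after the other. -/
def updateP (U : Receivers K N D) (W : Weights K D) (P : Precoders M K D) : Precoders M K D :=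
  ofRows (S.antennaLoop U W P M).1

/-- One iteration of PAPC-WMMSE: update `U`, then `W`, then the rows of `P`. -/
def step (x : Point M K N D) : Point M K N D :=
  let U := S.updateU x.2.2
  let W := S.updateW U x.2.2
  (U, W, S.updateP U W x.2.2)

/-- `x` is an iterative sequence generated by PAPC-WMMSE: the initial `P` obeys the per-antenna
power constraints, the initial `W_k` are identity matrices, and each iterate arises from the one
before by one iteration. (The initial `U` is never read.) -/
def IsIterateSeq (x : ℕ → Point M K N D) : Prop :=
  (x 0).2.2 ∈ S.feasibleP ∧ (∀ k, (x 0).2.1 k = 1) ∧ ∀ t, x (t + 1) = S.step (x t)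

end System

end PAPC

end

/-! For fixed precoders, completing the square in `U` and then using log λ ≤ λ - 1 on eigenvalues in
`W` shows that the weighted sum-MSE has minimum `optValue P`, a constant minus the weighted
sum-rate, attained at the algorithm's updates (`optValue_le_wmmse`, `wmmse_update`). For fixed `U`
and `W` it is a convex quadratic in the rows of the precoder (`wmmse_ofRows`), and the power
constraints form a product of balls, one per row; each antenna pass minimizes exactly over one ball
(`wmmse_newRow_le`). So the algorithm is block coordinate descent and the objective decreases.

The difficulty is that a row subproblem can be degenerate (a_m = 0 at a limit), so uniqueness of
minimizers and continuity of the update are unavailable. Instead, all intermediate stages of a sweep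
are passed to the limit along one ultrafilter. Monotonicity forces every limiting stage to have the
same value, and each one is optimal for the row about to be updated. A convex quadratic with equal
end values and no smaller midpoint value on a segment has that direction in its kernel, so
consecutive limiting stages differ by kernel directions, which never affect the objective.
Optimality for each row thus carries over to the last stage, `P⋆` (`rowwise_optimal_of_stages`).

At such a point the derivative is nonnegative in the (U, W) directions and in each row direction,
and linearity adds these up. For the sum-rate, `wmmse` with `U⋆`, `W⋆` frozen lies above `optValue`
and touches it at `P⋆`, so the two gradients in `P` agree there (`isStationary_of_blockwise`). -/

noncomputable section

open scoped Matrix ComplexOrder Matrix.Norms.Elementwise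
open Filter Topology

/-! ### Differentiability of matrix-valued maps -/

section MatrixCalculus

variable {F : Type*} [NormedAddCommGroup F] [NormedSpace ℝ F] {x : F}
  {l m n : Type*} [Fintype m] [Fintype n]

theorem DifferentiableAt.matrix_mul {f : F → Matrix l m ℂ} {g : F → Matrix m n ℂ}
    (hf : DifferentiableAt ℝ f x) (hg : DifferentiableAt ℝ g x) :
    DifferentiableAt ℝ (fun x => f x * g x) x := by
  refine differentiableAt_pi.2 fun i => differentiableAt_pi.2 fun j => ?_
  simp only [Matrix.mul_apply]
  have h1 := fun i => differentiableAt_pi.1 (differentiableAt_pi.1 hf i)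
  have h2 := fun i => differentiableAt_pi.1 (differentiableAt_pi.1 hg i)
  fun_prop (disch := simp [*])

theorem DifferentiableAt.matrix_conjTranspose [Fintype l] {f : F → Matrix l m ℂ}
    (hf : DifferentiableAt ℝ f x) : DifferentiableAt ℝ (fun x => (f x)ᴴ) x := by
  refine differentiableAt_pi.2 fun i => differentiableAt_pi.2 fun j => ?_
  exact (differentiableAt_pi.1 (differentiableAt_pi.1 hf j) i).star

theorem DifferentiableAt.matrix_det [DecidableEq n] {f : F → Matrix n n ℂ}
    (hf : DifferentiableAt ℝ f x) : DifferentiableAt ℝ (fun x => (f x).det) x := by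
  have h1 := fun i => differentiableAt_pi.1 (differentiableAt_pi.1 hf i)
  simp only [Matrix.det_apply']
  refine DifferentiableAt.fun_sum fun s _ => ?_
  refine (differentiableAt_const _).mul ?_
  exact (HasFDerivAt.finsetProd (u := Finset.univ) (g := fun i x => f x (s i) i) fun i _ =>
    (h1 (s i) i).hasFDerivAt).differentiableAt

theorem DifferentiableAt.matrix_trace {f : F → Matrix n n ℂ}
    (hf : DifferentiableAt ℝ f x) : DifferentiableAt ℝ (fun x => (f x).trace) x := by
  have h1 := fun i => differentiableAt_pi.1 (differentiableAt_pi.1 hf i)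
  simp only [Matrix.trace, Matrix.diag]
  exact DifferentiableAt.fun_sum (A := fun i x => f x i i) fun i _ => h1 i i

theorem DifferentiableAt.complex_re {f : F → ℂ} (hf : DifferentiableAt ℝ f x) :
    DifferentiableAt ℝ (fun x => (f x).re) x :=
  Complex.reCLM.differentiableAt.comp x hf

end MatrixCalculus

/-! ### Positive definite matrices -/

namespace Matrix

variable {m n : Type*} [Fintype m] [Fintype n] [DecidableEq m] [DecidableEq n]

theorem PosDef.re_det_pos {A : Matrix n n ℂ} (hA : A.PosDef) : 0 < A.det.re :=
  (Complex.pos_iff.1 hA.det_pos).1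

theorem PosDef.ofReal_re_det {A : Matrix n n ℂ} (hA : A.PosDef) : (A.det.re : ℂ) = A.det :=
  Complex.ext rfl (Complex.pos_iff.1 hA.det_pos).2

theorem PosDef.log_re_det_mul {A B : Matrix n n ℂ} (hA : A.PosDef) (hB : B.PosDef) :
    Real.log (A * B).det.re = Real.log A.det.re + Real.log B.det.re := by
  rw [← Real.log_mul hA.re_det_pos.ne' hB.re_det_pos.ne', det_mul, ← hA.ofReal_re_det,
    ← hB.ofReal_re_det, ← Complex.ofReal_mul, Complex.ofReal_re, Complex.ofReal_re,
    Complex.ofReal_re]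

theorem PosDef.log_re_det_inv {A : Matrix n n ℂ} (hA : A.PosDef) :
    Real.log A⁻¹.det.re = -Real.log A.det.re := by
  have h := hA.log_re_det_mul hA.inv
  rw [mul_nonsing_inv _ ((isUnit_iff_isUnit_det _).1 hA.isUnit)] at h
  simp only [det_one, Complex.one_re, Real.log_one] at h
  linarith

theorem PosDef.log_re_det_le {A : Matrix n n ℂ} (hA : A.PosDef) :
    Real.log A.det.re ≤ A.trace.re - Fintype.card n := by
  have h1 : A.det.re = ∏ i, hA.1.eigenvalues i := by
    rw [hA.1.det_eq_prod_eigenvalues]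
    simp [← Complex.ofReal_prod]
  have h2 : A.trace.re = ∑ i, hA.1.eigenvalues i := by
    rw [hA.1.trace_eq_sum_eigenvalues]
    simp
  rw [h1, h2, Real.log_prod fun i _ => (hA.eigenvalues_pos i).ne']
  have h3 : (Fintype.card n : ℝ) = ∑ _i : n, (1 : ℝ) := by simp
  rw [h3, ← Finset.sum_sub_distrib]
  exact Finset.sum_le_sum fun i _ => Real.log_le_sub_one_of_pos (hA.eigenvalues_pos i)

open scoped MatrixOrder in
theorem PosSemidef.exists_conjTranspose_mul_self {A : Matrix n n ℂ} (hA : A.PosSemidef) :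
    ∃ B : Matrix n n ℂ, A = Bᴴ * B :=
  CStarAlgebra.nonneg_iff_eq_star_mul_self.mp hA.nonneg

theorem PosSemidef.re_trace_mul_nonneg {A B : Matrix n n ℂ} (hA : A.PosSemidef)
    (hB : B.PosSemidef) : 0 ≤ (A * B).trace.re := by
  obtain ⟨C, rfl⟩ := hB.exists_conjTranspose_mul_self
  rw [← Matrix.mul_assoc, trace_mul_comm, ← Matrix.mul_assoc]
  exact (Complex.nonneg_iff.1 (hA.mul_mul_conjTranspose_same C).trace_nonneg).1

theorem PosSemidef.mul_eq_zero_of_trace_eq_zero {m n : Type*} [Fintype m] [Fintype n]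
    [DecidableEq n] {A : Matrix n n ℂ} (hA : A.PosSemidef)
    {X : Matrix m n ℂ} (h : (X * A * Xᴴ).trace.re = 0) : X * A = 0 := by
  obtain ⟨C, rfl⟩ := hA.exists_conjTranspose_mul_self
  have h0 : X * (Cᴴ * C) * Xᴴ = (C * Xᴴ)ᴴ * (C * Xᴴ) := by
    simp [conjTranspose_mul, Matrix.mul_assoc]
  have h1 : (X * (Cᴴ * C) * Xᴴ).trace = 0 :=
    Complex.ext h (Complex.nonneg_iff.1
      (hA.mul_mul_conjTranspose_same X).trace_nonneg).2.symm
  rw [h0, trace_conjTranspose_mul_self_eq_zero_iff] at h1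
  have h2 : X * Cᴴ = 0 := by
    have := congrArg (fun Z : Matrix n m ℂ => Zᴴ) h1
    simpa only [conjTranspose_mul, conjTranspose_conjTranspose, conjTranspose_zero] using this
  rw [← Matrix.mul_assoc, h2, Matrix.zero_mul]

/-- With B = CᴴC, the matrix C A Cᴴ is positive definite and has the trace and determinant of A B,
so `log_re_det_le` applies to it. Used with A a weight and B an MSE matrix. -/
theorem PosDef.add_log_re_det_le {A B : Matrix n n ℂ} (hA : A.PosDef) (hB : B.PosDef) :
    Fintype.card n + Real.log B.det.re ≤ (A * B).trace.re - Real.log A.det.re := by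
  obtain ⟨C, rfl⟩ := hB.posSemidef.exists_conjTranspose_mul_self
  have hC : IsUnit C := by
    have := hB.isUnit
    rw [isUnit_iff_isUnit_det, det_mul, IsUnit.mul_iff] at this
    exact (isUnit_iff_isUnit_det _).2 this.2
  have hX : (C * A * Cᴴ).PosDef :=
    (IsUnit.posDef_star_right_conjugate_iff hC).2 hA
  have h := hX.log_re_det_le
  have h1 : (C * A * Cᴴ).det = (A * (Cᴴ * C)).det := by
    simp only [det_mul]; ring
  rw [h1, hA.log_re_det_mul hB, Matrix.mul_assoc, trace_mul_comm, Matrix.mul_assoc] at h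
  linarith

end Matrix

/-! ### Linear receivers and the mean squared error -/

namespace Matrix

variable {m n : Type*} [Fintype m] [Fintype n] [DecidableEq m] [DecidableEq n]
  {N : Matrix n n ℂ}

theorem PosDef.add_mul_conjTranspose {m n : Type*} [Fintype m] [Fintype n]
    {N : Matrix n n ℂ} (hN : N.PosDef) (T : Matrix n m ℂ) :
    (N + T * Tᴴ).PosDef :=
  hN.add_posSemidef (posSemidef_self_mul_conjTranspose T)

/-- Completion of the square in U: the last term is positive semidefinite and vanishes at the MMSE
receiver. -/
theorem mse_eq_add (hN : N.PosDef) (T U : Matrix n m ℂ) :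
    (1 - Uᴴ * T) * (1 - Uᴴ * T)ᴴ + Uᴴ * N * U =
      (1 - Tᴴ * (N + T * Tᴴ)⁻¹ * T) +
        (U - (N + T * Tᴴ)⁻¹ * T)ᴴ * (N + T * Tᴴ) * (U - (N + T * Tᴴ)⁻¹ * T) := by
  have hR := hN.add_mul_conjTranspose T
  set R := N + T * Tᴴ with hRdef
  have hu : IsUnit R.det := (isUnit_iff_isUnit_det _).1 hR.isUnit
  have hRi : (R⁻¹)ᴴ = R⁻¹ := hR.inv.1
  have e1 : (U - R⁻¹ * T)ᴴ * R * (U - R⁻¹ * T) =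
      Uᴴ * R * U - Uᴴ * T - Tᴴ * U + Tᴴ * R⁻¹ * T := by
    have h1 : R * (R⁻¹ * T) = T := by rw [← Matrix.mul_assoc, mul_nonsing_inv _ hu, Matrix.one_mul]
    have h2 : Tᴴ * R⁻¹ * R = Tᴴ := by rw [Matrix.mul_assoc, nonsing_inv_mul _ hu, Matrix.mul_one]
    simp only [conjTranspose_sub, conjTranspose_mul, hRi, Matrix.sub_mul, Matrix.mul_sub, h2]
    rw [Matrix.mul_assoc Uᴴ R (R⁻¹ * T), h1]
    simp only [← Matrix.mul_assoc]
    abel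
  rw [e1, hRdef]
  simp only [conjTranspose_sub, conjTranspose_mul, conjTranspose_one, conjTranspose_conjTranspose,
    Matrix.sub_mul, Matrix.mul_sub, Matrix.mul_add, Matrix.add_mul, Matrix.one_mul, Matrix.mul_one,
    ← Matrix.mul_assoc]
  abel

theorem det_one_sub_mmse (hN : N.PosDef) (T : Matrix n m ℂ) :
    (1 - Tᴴ * (N + T * Tᴴ)⁻¹ * T).det = ((N + T * Tᴴ)⁻¹ * N).det := by
  have hR := hN.add_mul_conjTranspose T
  have hu : IsUnit (N + T * Tᴴ).det := (isUnit_iff_isUnit_det _).1 hR.isUnit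
  have h : (N + T * Tᴴ)⁻¹ * N = 1 - (N + T * Tᴴ)⁻¹ * T * Tᴴ := by
    rw [eq_sub_iff_add_eq, Matrix.mul_assoc, ← Matrix.mul_add, nonsing_inv_mul _ hu]
  rw [h, Matrix.mul_assoc, det_one_sub_mul_comm]

theorem posDef_mmse (hN : N.PosDef) (T : Matrix n m ℂ) :
    (1 - Tᴴ * (N + T * Tᴴ)⁻¹ * T).PosDef := by
  have hR := hN.add_mul_conjTranspose T
  have h := mse_eq_add hN T ((N + T * Tᴴ)⁻¹ * T)
  -- At the MMSE receiver the square drops out, leaving the MSE matrix as a visible sum of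
  -- semidefinite terms; definiteness then follows from the determinant.
  rw [sub_self, conjTranspose_zero, Matrix.zero_mul, Matrix.zero_mul, add_zero] at h
  have hpsd : (1 - Tᴴ * (N + T * Tᴴ)⁻¹ * T).PosSemidef := by
    rw [← h]
    exact (posSemidef_self_mul_conjTranspose _).add (hN.posSemidef.conjTranspose_mul_mul_same _)
  rw [hpsd.posDef_iff_det_ne_zero, det_one_sub_mmse hN, det_mul]
  exact mul_ne_zero hR.inv.det_pos.ne' hN.det_pos.ne'

theorem log_re_det_mmse (hN : N.PosDef) (T : Matrix n m ℂ) :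
    Real.log (1 - Tᴴ * (N + T * Tᴴ)⁻¹ * T).det.re =
      Real.log N.det.re - Real.log (N + T * Tᴴ).det.re := by
  have hR := hN.add_mul_conjTranspose T
  rw [det_one_sub_mmse hN, hR.inv.log_re_det_mul hN, hR.log_re_det_inv]
  ring

end Matrix

namespace PAPC.System

variable {M K : ℕ} {N D : Fin K → ℕ} (S : System M K N D)

/-! ### Covariances and rates -/

theorem interf_posDef (P : Precoders M K D) (k : Fin K) : (S.interf P k).PosDef := by
  refine Matrix.PosDef.posSemidef_add (Matrix.posSemidef_sum _ fun j _ => ?_) ?_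
  · have := Matrix.posSemidef_self_mul_conjTranspose (S.H k * P j)
    rwa [Matrix.conjTranspose_mul, ← Matrix.mul_assoc] at this
  · refine Matrix.PosDef.one.smul ?_
    have : (0 : ℝ) < S.σ k ^ 2 := pow_pos (S.σ_pos k) 2
    exact_mod_cast this

theorem recvCov_eq (P : Precoders M K D) (k : Fin K) :
    S.recvCov P k = S.interf P k + (S.H k * P k) * (S.H k * P k)ᴴ := by
  unfold recvCov interf
  rw [← Finset.sum_erase_add _ _ (Finset.mem_univ k), Matrix.conjTranspose_mul]
  simp only [Matrix.mul_assoc]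
  abel

theorem recvCov_posDef (P : Precoders M K D) (k : Fin K) : (S.recvCov P k).PosDef := by
  rw [recvCov_eq]
  exact (S.interf_posDef P k).add_mul_conjTranspose _

theorem isUnit_det_recvCov (P : Precoders M K D) (k : Fin K) : IsUnit (S.recvCov P k).det :=
  (Matrix.isUnit_iff_isUnit_det _).1 (S.recvCov_posDef P k).isUnit

theorem rate_eq (P : Precoders M K D) (k : Fin K) :
    S.rate P k = Real.log (S.recvCov P k).det.re - Real.log (S.interf P k).det.re := by
  have hN := S.interf_posDef P k
  have h : 1 + S.H k * P k * (P k)ᴴ * (S.H k)ᴴ * (S.interf P k)⁻¹ =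
      S.recvCov P k * (S.interf P k)⁻¹ := by
    rw [recvCov_eq, Matrix.add_mul,
      Matrix.mul_nonsing_inv _ ((Matrix.isUnit_iff_isUnit_det _).1 hN.isUnit),
      Matrix.conjTranspose_mul]
    simp only [Matrix.mul_assoc]
  unfold rate
  rw [h, (S.recvCov_posDef P k).log_re_det_mul hN.inv, hN.log_re_det_inv]
  ring

/-! ### Optimal receivers and weights -/

/-- The MSE matrix of the optimal receiver. -/
def mmse (P : Precoders M K D) (k : Fin K) : Matrix (Fin (D k)) (Fin (D k)) ℂ :=
  1 - (S.H k * P k)ᴴ * (S.recvCov P k)⁻¹ * (S.H k * P k)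

theorem mmse_posDef (P : Precoders M K D) (k : Fin K) : (S.mmse P k).PosDef := by
  unfold mmse
  rw [recvCov_eq]
  exact Matrix.posDef_mmse (S.interf_posDef P k) _

theorem log_re_det_mmse (P : Precoders M K D) (k : Fin K) :
    Real.log (S.mmse P k).det.re = -S.rate P k := by
  rw [rate_eq]
  unfold mmse
  rw [recvCov_eq, Matrix.log_re_det_mmse (S.interf_posDef P k)]
  ring

theorem mse_eq (U : Receivers K N D) (P : Precoders M K D) (k : Fin K) :
    S.mse U P k = S.mmse P k +
      (U k - S.updateU P k)ᴴ * S.recvCov P k * (U k - S.updateU P k) := by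
  unfold mse mmse updateU
  rw [recvCov_eq, ← Matrix.mse_eq_add (S.interf_posDef P k)]
  simp only [Matrix.mul_assoc]

theorem one_sub_updateU (P : Precoders M K D) (k : Fin K) :
    1 - (S.updateU P k)ᴴ * S.H k * P k = S.mmse P k := by
  unfold mmse updateU
  rw [Matrix.conjTranspose_mul, (S.recvCov_posDef P k).inv.1]
  simp only [Matrix.mul_assoc]

theorem updateW_updateU (P : Precoders M K D) (k : Fin K) :
    S.updateW (S.updateU P) P k = (S.mmse P k)⁻¹ := by
  unfold updateW
  rw [one_sub_updateU]

theorem updateW_posDef (P : Precoders M K D) (k : Fin K) :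
    (S.updateW (S.updateU P) P k).PosDef := by
  rw [updateW_updateU]
  exact (S.mmse_posDef P k).inv

/-- The weighted sum-MSE objective minimized over receivers and weights. -/
def optValue (P : Precoders M K D) : ℝ := (∑ k, S.α k * D k) - S.wsr P

theorem optValue_eq (P : Precoders M K D) :
    S.optValue P = ∑ k, S.α k * (D k - S.rate P k) := by
  simp only [optValue, wsr, mul_sub, Finset.sum_sub_distrib]

theorem optValue_le_wmmse (U : Receivers K N D) (W : Weights K D) (P : Precoders M K D)
    (hW : ∀ k, (W k).PosDef) : S.optValue P ≤ S.wmmse (U, W, P) := by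
  rw [optValue_eq]
  refine Finset.sum_le_sum fun k _ => mul_le_mul_of_nonneg_left ?_ (S.α_nonneg k)
  have h1 := (hW k).add_log_re_det_le (S.mmse_posDef P k)
  have h2 := (hW k).posSemidef.re_trace_mul_nonneg
    ((S.recvCov_posDef P k).posSemidef.conjTranspose_mul_mul_same (U k - S.updateU P k))
  rw [log_re_det_mmse, Fintype.card_fin] at h1
  change _ ≤ (W k * S.mse U P k).trace.re - Real.log (W k).det.re
  rw [mse_eq, Matrix.mul_add, Matrix.trace_add, Complex.add_re]
  linarith

theorem wmmse_update (P : Precoders M K D) :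
    S.wmmse (S.updateU P, S.updateW (S.updateU P) P, P) = S.optValue P := by
  rw [optValue_eq]
  refine Finset.sum_congr rfl fun k _ => ?_
  change S.α k * ((S.updateW (S.updateU P) P k * S.mse (S.updateU P) P k).trace.re -
    Real.log (S.updateW (S.updateU P) P k).det.re) = _
  have hE := S.mmse_posDef P k
  rw [updateW_updateU, mse_eq, sub_self, Matrix.mul_zero, add_zero,
    Matrix.nonsing_inv_mul _ ((Matrix.isUnit_iff_isUnit_det _).1 hE.isUnit),
    hE.log_re_det_inv, log_re_det_mmse]
  simp

/-! ### Differentiability of the objectives -/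

section Differentiability

variable {F : Type*} [NormedAddCommGroup F] [NormedSpace ℝ F] {z : F}

theorem differentiableAt_interf {P : F → Precoders M K D}
    (hP : DifferentiableAt ℝ P z) (k : Fin K) :
    DifferentiableAt ℝ (fun z => S.interf (P z) k) z := by
  unfold interf
  refine DifferentiableAt.add_const _ (DifferentiableAt.fun_sum fun j _ => ?_)
  have h := differentiableAt_pi.1 hP j
  exact (((differentiableAt_const _).matrix_mul h).matrix_mul h.matrix_conjTranspose).matrix_mul
    (differentiableAt_const _)

theorem differentiableAt_recvCov {P : F → Precoders M K D}
    (hP : DifferentiableAt ℝ P z) (k : Fin K) :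
    DifferentiableAt ℝ (fun z => S.recvCov (P z) k) z := by
  unfold recvCov
  refine DifferentiableAt.add_const _ (DifferentiableAt.fun_sum fun j _ => ?_)
  have h := differentiableAt_pi.1 hP j
  exact (((differentiableAt_const _).matrix_mul h).matrix_mul h.matrix_conjTranspose).matrix_mul
    (differentiableAt_const _)

theorem differentiableAt_wsr (P : Precoders M K D) : DifferentiableAt ℝ S.wsr P := by
  unfold wsr
  refine DifferentiableAt.fun_sum fun k _ => DifferentiableAt.const_mul ?_ _
  simp only [rate_eq]
  exact ((S.differentiableAt_recvCov differentiableAt_id k).matrix_det.complex_re.log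
      (S.recvCov_posDef P k).re_det_pos.ne').sub
    ((S.differentiableAt_interf differentiableAt_id k).matrix_det.complex_re.log
      (S.interf_posDef P k).re_det_pos.ne')

theorem differentiableAt_wmmse (x : Point M K N D) (hW : ∀ k, (x.2.1 k).PosDef) :
    DifferentiableAt ℝ S.wmmse x := by
  have hU : ∀ k, DifferentiableAt ℝ (fun x : Point M K N D => x.1 k) x :=
    differentiableAt_pi.1 differentiableAt_fst
  have hW' : ∀ k, DifferentiableAt ℝ (fun x : Point M K N D => x.2.1 k) x :=
    differentiableAt_pi.1 (differentiableAt_fst.comp x differentiableAt_snd)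
  have hP : DifferentiableAt ℝ (fun x : Point M K N D => x.2.2) x :=
    differentiableAt_snd.comp x differentiableAt_snd
  have hP' := differentiableAt_pi.1 hP
  unfold wmmse
  refine DifferentiableAt.fun_sum fun k _ => DifferentiableAt.const_mul (DifferentiableAt.sub ?_
    ((hW' k).matrix_det.complex_re.log (hW k).re_det_pos.ne')) _
  refine ((hW' k).matrix_mul ?_).matrix_trace.complex_re
  have h1 : DifferentiableAt ℝ
      (fun x : Point M K N D => 1 - (x.1 k)ᴴ * S.H k * x.2.2 k) x :=
    (differentiableAt_const _).sub
      (((hU k).matrix_conjTranspose.matrix_mul (differentiableAt_const _)).matrix_mul (hP' k))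
  exact (h1.matrix_mul h1.matrix_conjTranspose).add
    (((hU k).matrix_conjTranspose.matrix_mul (S.differentiableAt_interf hP k)).matrix_mul (hU k))

end Differentiability

end PAPC.System

theorem HasFDerivAt.nonneg_of_forall_le {F : Type*} [NormedAddCommGroup F] [NormedSpace ℝ F]
    {f : F → ℝ} {f' : F →L[ℝ] ℝ} {x v : F} (hf : HasFDerivAt f f' x)
    (h : ∀ s : ℝ, 0 ≤ s → s ≤ 1 → f x ≤ f (x + s • v)) : 0 ≤ f' v := by
  have hmin : IsMinOn f (segment ℝ x (x + v)) x := by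
    intro y hy
    rw [segment_eq_image'] at hy
    obtain ⟨s, hs, rfl⟩ := hy
    simpa using h s hs.1 hs.2
  exact hmin.localize.hasFDerivWithinAt_nonneg hf.hasFDerivWithinAt
    (mem_posTangentConeAt_of_segment_subset subset_rfl)

namespace PAPC

variable {M K : ℕ} {N D : Fin K → ℕ}

/-! ### Rows of the precoders -/

namespace System

@[simp]
theorem ofRows_row (P : Precoders M K D) : ofRows (row P) = P := by
  ext k m d
  simp [ofRows, row]

@[simp]
theorem row_ofRows (p : Fin M → (Σ k, Fin (D k)) → ℂ) : row (ofRows p) = p := by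
  ext m d
  simp [ofRows, row]

theorem ofRows_add (p q : Fin M → (Σ k, Fin (D k)) → ℂ) :
    ofRows (p + q) = ofRows p + ofRows q := by
  ext k m d
  simp [ofRows]

theorem ofRows_smul (s : ℝ) (p : Fin M → (Σ k, Fin (D k)) → ℂ) :
    ofRows (s • p) = s • ofRows p := by
  ext k m d
  simp [ofRows]

theorem ofRows_sum_single (p : Fin M → (Σ k, Fin (D k)) → ℂ) :
    ∑ m, ofRows (Pi.single m (p m)) = ofRows p := by
  ext k i d
  simp only [Finset.sum_apply, ofRows, Matrix.sum_apply, Matrix.of_apply]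
  rw [Finset.sum_eq_single i]
  · simp
  · intro m _ hm
    simp [Pi.single_eq_of_ne hm.symm]
  · simp

variable (S : System M K N D)

/-- The constraints decouple over antennas into one Euclidean ball per row; hence rowwise optimality
can give stationarity. -/
theorem mem_feasibleP_iff (P : Precoders M K D) :
    P ∈ S.feasibleP ↔ ∀ m, ‖WithLp.toLp 2 (row P m)‖ ≤ √(S.Pow m) := by
  refine forall_congr' fun m => ?_
  have h : (∑ k, (P k * (P k)ᴴ) m m).re = ‖WithLp.toLp 2 (row P m)‖ ^ 2 := by
    rw [EuclideanSpace.norm_sq_eq, Fintype.sum_sigma, Complex.re_sum]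
    refine Finset.sum_congr rfl fun k _ => ?_
    rw [Matrix.mul_apply, Complex.re_sum]
    refine Finset.sum_congr rfl fun d _ => ?_
    simp [row, Complex.mul_conj, Complex.normSq_eq_norm_sq]
    norm_cast
  rw [h]
  exact (Real.le_sqrt (norm_nonneg _) (S.Pow_nonneg m)).symm

/-! ### From blockwise optimality to stationarity -/

theorem nonneg_of_rowwise_le {x : Point M K N D} (hP : x.2.2 ∈ S.feasibleP)
    (hrow : ∀ m q, ‖WithLp.toLp 2 q‖ ≤ √(S.Pow m) →
      S.wmmse x ≤ S.wmmse (x.1, x.2.1, ofRows (Function.update (row x.2.2) m q)))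
    {f' : Point M K N D →L[ℝ] ℝ} (hf : HasFDerivAt S.wmmse f' x)
    {Q : Precoders M K D} (hQ : Q ∈ S.feasibleP) :
    0 ≤ f' (0, 0, Q - x.2.2) := by
  set z := row Q - row x.2.2 with hz
  have hdec : ((0, 0, Q - x.2.2) : Point M K N D) =
      ∑ m, ((0, 0, ofRows (Pi.single m (z m))) : Point M K N D) := by
    have : Q - x.2.2 = ofRows z := by
      ext k m d
      simp [hz, ofRows, row]
    rw [this, ← ofRows_sum_single z]
    refine Prod.ext ?_ (Prod.ext ?_ ?_) <;> simp [Prod.fst_sum, Prod.snd_sum]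
  rw [hdec, map_sum]
  refine Finset.sum_nonneg fun m _ => hf.nonneg_of_forall_le fun s hs0 hs1 => ?_
  -- Moving along a single-row direction changes row m only, and convexity of its ball keeps that
  -- row admissible.
  have hx : x + s • ((0, 0, ofRows (Pi.single m (z m))) : Point M K N D) =
      (x.1, x.2.1, ofRows (Function.update (row x.2.2) m (row x.2.2 m + s • z m))) := by
    refine Prod.ext (by simp) (Prod.ext (by simp) ?_)
    have : Function.update (row x.2.2) m (row x.2.2 m + s • z m) =
        row x.2.2 + s • (Pi.single m (z m) : Fin M → (Σ k, Fin (D k)) → ℂ) := by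
      ext i d
      rcases eq_or_ne i m with rfl | h
      · simp
      · simp [h]
    rw [this, ofRows_add, ofRows_smul, ofRows_row]
    rfl
  rw [hx]
  refine hrow m _ ?_
  have hc : WithLp.toLp 2 (row x.2.2 m + s • z m) =
      (1 - s) • WithLp.toLp 2 (row x.2.2 m) + s • WithLp.toLp 2 (row Q m) := by
    ext d
    simp [hz]
    ring
  rw [hc]
  have h1 := (S.mem_feasibleP_iff _).1 hP m
  have h2 := (S.mem_feasibleP_iff _).1 hQ m
  calc _ ≤ ‖(1 - s) • WithLp.toLp 2 (row x.2.2 m)‖ + ‖s • WithLp.toLp 2 (row Q m)‖ :=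
        norm_add_le _ _
    _ = (1 - s) * ‖WithLp.toLp 2 (row x.2.2 m)‖ + s * ‖WithLp.toLp 2 (row Q m)‖ := by
        rw [norm_smul, norm_smul, Real.norm_of_nonneg hs0, Real.norm_of_nonneg (by linarith)]
    _ ≤ (1 - s) * √(S.Pow m) + s * √(S.Pow m) :=
        add_le_add (mul_le_mul_of_nonneg_left h1 (by linarith)) (mul_le_mul_of_nonneg_left h2 hs0)
    _ = √(S.Pow m) := by ring

theorem isStationary_of_blockwise {x : Point M K N D} (hW : ∀ k, (x.2.1 k).PosDef)
    (hP : x.2.2 ∈ S.feasibleP) (hopt : S.wmmse x = S.optValue x.2.2)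
    (hrow : ∀ m q, ‖WithLp.toLp 2 q‖ ≤ √(S.Pow m) →
      S.wmmse x ≤ S.wmmse (x.1, x.2.1, ofRows (Function.update (row x.2.2) m q))) :
    IsStationaryMin S.wmmse S.feasible x ∧ IsStationaryMax S.wsr S.feasibleP x.2.2 := by
  have hf := (S.differentiableAt_wmmse x hW).hasFDerivAt
  set f' := fderiv ℝ S.wmmse x
  have hrows := fun Q hQ => S.nonneg_of_rowwise_le hP hrow hf (Q := Q) hQ
  refine ⟨⟨⟨hW, hP⟩, f', hf, fun y hy => ?_⟩, ⟨hP, ?_⟩⟩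
  · have hdec : y - x = (y.1 - x.1, y.2.1 - x.2.1, 0) + (0, 0, y.2.2 - x.2.2) := by
      refine Prod.ext ?_ (Prod.ext ?_ ?_) <;> simp
    rw [hdec, map_add]
    refine add_nonneg (hf.nonneg_of_forall_le fun s hs0 hs1 => ?_) (hrows _ hy.2)
    have hx : x + s • ((y.1 - x.1, y.2.1 - x.2.1, 0) : Point M K N D) =
        (x.1 + s • (y.1 - x.1), x.2.1 + s • (y.2.1 - x.2.1), x.2.2) := by
      refine Prod.ext ?_ (Prod.ext ?_ ?_) <;> simp
    rw [hx, hopt]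
    refine S.optValue_le_wmmse _ _ _ fun k => ?_
    -- For s > 0 the y-term supplies definiteness, the other being only semidefinite when s = 1; s =
    -- 0 is separate because the y-term vanishes.
    rcases hs0.eq_or_lt with rfl | hs
    · simpa using hW k
    have h : (x.2.1 + s • (y.2.1 - x.2.1)) k =
        ((1 - s : ℝ) : ℂ) • x.2.1 k + ((s : ℝ) : ℂ) • y.2.1 k := by
      ext i j
      simp
      ring
    rw [h]
    refine Matrix.PosDef.posSemidef_add ((hW k).posSemidef.smul ?_) ((hy.1 k).smul ?_)
    · exact_mod_cast sub_nonneg.2 hs1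
    · exact_mod_cast hs
  · have hg : HasFDerivAt (fun P : Precoders M K D => S.wmmse (x.1, x.2.1, P))
        (f'.comp ((0 : Precoders M K D →L[ℝ] Receivers K N D).prod
          ((0 : Precoders M K D →L[ℝ] Weights K D).prod
            (ContinuousLinearMap.id ℝ (Precoders M K D))))) x.2.2 :=
      HasFDerivAt.comp (g := S.wmmse) x.2.2 hf
        ((hasFDerivAt_const x.1 x.2.2).prodMk
          ((hasFDerivAt_const x.2.1 x.2.2).prodMk (hasFDerivAt_id x.2.2)))
    have hs := (S.differentiableAt_wsr x.2.2).hasFDerivAt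
    refine ⟨_, hs, fun Q hQ => ?_⟩
    -- `wmmse` at frozen `U`, `W` majorizes a constant minus `wsr`, with equality at `x.2.2`; so the
    -- derivatives of the two summands cancel.
    have hmin : IsLocalMin (fun P => S.wmmse (x.1, x.2.1, P) + S.wsr P) x.2.2 := by
      refine Filter.Eventually.of_forall fun P => ?_
      have h := S.optValue_le_wmmse x.1 x.2.1 P hW
      change S.wmmse x + S.wsr x.2.2 ≤ S.wmmse (x.1, x.2.1, P) + S.wsr P
      rw [hopt]
      unfold optValue at h ⊢
      linarith
    have h0 := hmin.hasFDerivAt_eq_zero (hg.add hs)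
    have h1 := DFunLike.congr_fun h0 (Q - x.2.2)
    have h2 := hrows Q hQ
    have h3 : f' (0, 0, Q - x.2.2) + fderiv ℝ S.wsr x.2.2 (Q - x.2.2) = 0 := h1
    linarith

end System

end PAPC

/-! ### Quadratic functions of a matrix -/

namespace Matrix

variable {n : Type*} [Fintype n] [DecidableEq n]

/-- The real quadratic function `X ↦ Tr (X Ω Xᴴ) - 2 Re Tr (Ω Xᴴ)`. -/
def quadFun {n : Type*} [Fintype n] (Ω X : Matrix n n ℂ) : ℝ :=
  (X * Ω * Xᴴ).trace.re - 2 * (Ω * Xᴴ).trace.re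

theorem quadFun_add {n : Type*} [Fintype n] {Ω : Matrix n n ℂ}
    (hΩ : Ω.IsHermitian) (X Z : Matrix n n ℂ) :
    quadFun Ω (X + Z) =
      quadFun Ω X + (Z * Ω * Zᴴ).trace.re + 2 * ((X * Ω - Ω) * Zᴴ).trace.re := by
  have h : (Z * Ω * Xᴴ).trace.re = (X * Ω * Zᴴ).trace.re := by
    have : Z * Ω * Xᴴ = (X * Ω * Zᴴ)ᴴ := by
      simp only [conjTranspose_mul, conjTranspose_conjTranspose, hΩ.eq, Matrix.mul_assoc]
    rw [this, trace_conjTranspose]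
    simp
  simp only [quadFun, conjTranspose_add, Matrix.add_mul, Matrix.mul_add, Matrix.sub_mul, trace_add,
    trace_sub, Complex.add_re, Complex.sub_re, h]
  ring

/-- Along X + sZ the function is f₀ + s l + s² c with c = Tr(Z Ω Zᴴ) ≥ 0. Equal values at 0 and 1
give l = -c, so the midpoint value is f₀ - c/4, forcing c = 0. -/
theorem PosSemidef.mul_eq_zero_of_quadFun {Ω : Matrix n n ℂ} (hΩ : Ω.PosSemidef)
    {X Z : Matrix n n ℂ} (h1 : quadFun Ω (X + Z) = quadFun Ω X)
    (h2 : quadFun Ω X ≤ quadFun Ω (X + (2⁻¹ : ℝ) • Z)) : Z * Ω = 0 := by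
  refine hΩ.mul_eq_zero_of_trace_eq_zero (le_antisymm ?_
    (Complex.nonneg_iff.1 (hΩ.mul_mul_conjTranspose_same Z).trace_nonneg).1)
  rw [quadFun_add hΩ.1] at h1 h2
  simp only [conjTranspose_smul, star_trivial, Matrix.smul_mul, Matrix.mul_smul, trace_smul,
    Complex.smul_re, smul_eq_mul] at h2
  linarith

theorem quadFun_add_of_mul_eq_zero {Ω : Matrix n n ℂ} (hΩ : Ω.IsHermitian)
    (X : Matrix n n ℂ) {Z : Matrix n n ℂ} (h : Z * Ω = 0) :
    quadFun Ω (X + Z) = quadFun Ω X := by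
  have h1 : Ω * Zᴴ = 0 := by
    have : Ω * Zᴴ = (Z * Ω)ᴴ := by rw [conjTranspose_mul, hΩ.eq]
    rw [this, h, conjTranspose_zero]
  rw [quadFun_add hΩ, h, Matrix.sub_mul, Matrix.mul_assoc, h1]
  simp

end Matrix

/-! ### A quadratic problem on a ball -/

section BallProblem

variable {E : Type*} [NormedAddCommGroup E] [InnerProductSpace ℂ E] {a r : ℝ}

theorem norm_neg_min_smul_le (ha : 0 ≤ a) (hr : 0 ≤ r) (b : E) :
    ‖-((min (1 / a) (r / ‖b‖) : ℝ) : ℂ) • b‖ ≤ r := by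
  have hc : 0 ≤ min (1 / a) (r / ‖b‖) := by positivity
  rw [norm_smul, norm_neg, Complex.norm_real, Real.norm_of_nonneg hc]
  calc _ ≤ r / ‖b‖ * ‖b‖ := by gcongr; exact min_le_right _ _
    _ ≤ r := by
      rcases eq_or_ne ‖b‖ 0 with h | h
      · simpa [h] using hr
      · rw [div_mul_cancel₀ _ h]

/-- By Cauchy–Schwarz the best direction is -b, leaving the scalar problem of minimizing a t² - 2 t
‖b‖ over 0 ≤ t ≤ r, solved by min(‖b‖ / a, r). -/
theorem neg_min_smul_isMin (ha : 0 ≤ a) (hr : 0 ≤ r) {b : E} (hab : a = 0 → b = 0)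
    {q : E} (hq : ‖q‖ ≤ r) :
    a * ‖-((min (1 / a) (r / ‖b‖) : ℝ) : ℂ) • b‖ ^ 2 +
        2 * (inner ℂ (-((min (1 / a) (r / ‖b‖) : ℝ) : ℂ) • b) b).re ≤
      a * ‖q‖ ^ 2 + 2 * (inner ℂ q b).re := by
  have hc : 0 ≤ min (1 / a) (r / ‖b‖) := by positivity
  set c := min (1 / a) (r / ‖b‖) with hcdef
  have h1 : (inner ℂ (-(c : ℂ) • b) b).re = -(c * ‖b‖ ^ 2) := by
    rw [inner_smul_left, inner_self_eq_norm_sq_to_K]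
    simp
    norm_cast
    simp
  have h2 : ‖-(c : ℂ) • b‖ = c * ‖b‖ := by
    rw [norm_smul, norm_neg, Complex.norm_real, Real.norm_of_nonneg hc]
  have h3 : -(‖q‖ * ‖b‖) ≤ (inner ℂ q b).re :=
    (abs_le.1 ((Complex.abs_re_le_norm _).trans (norm_inner_le_norm q b))).1
  rw [h1, h2]
  rcases ha.eq_or_lt with ha0 | ha0
  · rw [hab ha0.symm]
    simp [← ha0]
  rcases (norm_nonneg b).eq_or_lt with hb | hb
  · rw [← hb] at h3 ⊢
    have : 0 ≤ a * ‖q‖ ^ 2 := by positivity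
    simp at h3 ⊢
    linarith
  suffices h : a * (c * ‖b‖) ^ 2 - 2 * (c * ‖b‖) * ‖b‖ ≤ a * ‖q‖ ^ 2 - 2 * ‖q‖ * ‖b‖ by
    linarith
  have hq0 := norm_nonneg q
  rcases le_total (1 / a) (r / ‖b‖) with h | h
  · have hca : a * (c * ‖b‖) = ‖b‖ := by
      rw [hcdef, min_eq_left h]
      field_simp
    generalize c * ‖b‖ = t at *
    rw [← hca]
    nlinarith [mul_nonneg ha (sq_nonneg (‖q‖ - t))]
  · have hcr : c * ‖b‖ = r := by
      rw [hcdef, min_eq_right h]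
      field_simp
    have har : a * r ≤ ‖b‖ := by
      rw [div_le_div_iff₀ hb ha0] at h
      linarith
    rw [hcr]
    have haq : a * ‖q‖ ≤ ‖b‖ := (mul_le_mul_of_nonneg_left hq ha).trans har
    -- The difference of the two sides factors as (r - ‖q‖)(2‖b‖ - a r - a‖q‖).
    nlinarith [mul_nonneg (sub_nonneg.2 hq) (by linarith : 0 ≤ 2 * ‖b‖ - a * r - a * ‖q‖)]

end BallProblem

namespace PAPC.System

variable {M K : ℕ} {N D : Fin K → ℕ} (S : System M K N D)

/-! ### The objective as a function of the stacked precoder -/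

/-- The matrix `C = ∑_l p_l h_lᴴ`. -/
def stack (p : Fin M → (Σ k, Fin (D k)) → ℂ) : Matrix (Σ k, Fin (D k)) (Σ k, Fin (N k)) ℂ :=
  ∑ l, Matrix.vecMulVec (p l) (star (S.col l))

/-- The matrix `blkdiag (α_k W_k)`. -/
def blockWeight (W : Weights K D) : Matrix (Σ k, Fin (D k)) (Σ k, Fin (D k)) ℂ :=
  Matrix.blockDiagonal' fun k => (S.α k : ℂ) • W k

/-- The matrix `C blkdiag (U_k)`, whose blocks are the adjoints of `U_kᴴ H_k P_j`. -/
def received (U : Receivers K N D) (p : Fin M → (Σ k, Fin (D k)) → ℂ) :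
    Matrix (Σ k, Fin (D k)) (Σ k, Fin (D k)) ℂ :=
  S.stack p * Matrix.blockDiagonal' U

theorem received_add (U : Receivers K N D) (p q : Fin M → (Σ k, Fin (D k)) → ℂ) :
    S.received U (p + q) = S.received U p + S.received U q := by
  simp only [received, stack, Pi.add_apply, Matrix.add_vecMulVec, Finset.sum_add_distrib,
    Matrix.add_mul]

theorem received_smul (U : Receivers K N D) (s : ℝ) (p : Fin M → (Σ k, Fin (D k)) → ℂ) :
    S.received U (s • p) = s • S.received U p := by
  simp only [received, stack, Pi.smul_apply, Matrix.smul_vecMulVec, ← Finset.smul_sum,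
    Matrix.smul_mul]

theorem _root_.Matrix.mul_blockDiagonal'_apply {ι l : Type*} {m n : ι → Type*} [Fintype ι]
    [DecidableEq ι] [∀ k, Fintype (m k)] (Y : Matrix l (Σ k, m k) ℂ)
    (w : ∀ k, Matrix (m k) (n k) ℂ) (a : l) (k : ι) (e : n k) :
    (Y * Matrix.blockDiagonal' w) a ⟨k, e⟩ = ∑ i, Y a ⟨k, i⟩ * w k i e := by
  rw [Matrix.mul_apply, Fintype.sum_sigma, Finset.sum_eq_single k]
  · simp
  · intro j _ hj
    exact Finset.sum_eq_zero fun i _ => by rw [Matrix.blockDiagonal'_apply_ne _ _ _ hj, mul_zero]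
  · simp

theorem received_apply (U : Receivers K N D) (p : Fin M → (Σ k, Fin (D k)) → ℂ)
    (j k : Fin K) (d : Fin (D j)) (e : Fin (D k)) :
    S.received U p ⟨j, d⟩ ⟨k, e⟩ = ((U k)ᴴ * S.H k * ofRows p j)ᴴ d e := by
  rw [received, Matrix.mul_blockDiagonal'_apply, Matrix.conjTranspose_mul,
    Matrix.conjTranspose_mul, Matrix.conjTranspose_conjTranspose, ← Matrix.mul_assoc,
    Matrix.mul_apply]
  refine Finset.sum_congr rfl fun i _ => ?_
  congr 1
  rw [stack, Matrix.sum_apply, Matrix.mul_apply]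
  refine Finset.sum_congr rfl fun l _ => ?_
  simp [Matrix.vecMulVec_apply, ofRows, col]

theorem trace_received_mul (U : Receivers K N D) (W : Weights K D)
    (p : Fin M → (Σ k, Fin (D k)) → ℂ) :
    (S.received U p * S.blockWeight W * (S.received U p)ᴴ).trace =
      ∑ k, S.α k * ∑ j, (W k * ((U k)ᴴ * S.H k * ofRows p j) *
        ((U k)ᴴ * S.H k * ofRows p j)ᴴ).trace := by
  have h : ∀ j k, (W k * ((U k)ᴴ * S.H k * ofRows p j) *
        ((U k)ᴴ * S.H k * ofRows p j)ᴴ).trace =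
      ∑ d, ∑ e, (∑ i, S.received U p ⟨j, d⟩ ⟨k, i⟩ * W k i e) *
        star (S.received U p ⟨j, d⟩ ⟨k, e⟩) := by
    intro j k
    rw [Matrix.mul_assoc, Matrix.trace_mul_comm, Matrix.mul_assoc, Matrix.trace_mul_comm,
      Matrix.trace]
    refine Finset.sum_congr rfl fun d _ => ?_
    rw [Matrix.diag_apply, Matrix.mul_apply]
    refine Finset.sum_congr rfl fun e _ => ?_
    rw [Matrix.mul_apply]
    simp only [received_apply, Matrix.conjTranspose_apply, star_star]
  simp only [h, Finset.mul_sum]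
  rw [Matrix.trace, Fintype.sum_sigma, Finset.sum_comm (s := Finset.univ)]
  refine Finset.sum_congr rfl fun j _ => ?_
  rw [Finset.sum_comm (s := Finset.univ)]
  refine Finset.sum_congr rfl fun d _ => ?_
  rw [Matrix.diag_apply, Matrix.mul_apply, Fintype.sum_sigma]
  refine Finset.sum_congr rfl fun k _ => Finset.sum_congr rfl fun e _ => ?_
  rw [blockWeight, Matrix.mul_blockDiagonal'_apply, Matrix.conjTranspose_apply, ← mul_assoc,
    Finset.mul_sum]
  congr 1
  refine Finset.sum_congr rfl fun i _ => ?_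
  rw [Matrix.smul_apply, smul_eq_mul]
  ring

theorem trace_mul_received (U : Receivers K N D) (W : Weights K D)
    (p : Fin M → (Σ k, Fin (D k)) → ℂ) :
    (S.blockWeight W * (S.received U p)ᴴ).trace =
      ∑ k, S.α k * (W k * ((U k)ᴴ * S.H k * ofRows p k)).trace := by
  have h : (S.blockWeight W * (S.received U p)ᴴ).trace =
      star (S.received U p * (S.blockWeight W)ᴴ).trace := by
    rw [← Matrix.trace_conjTranspose, Matrix.conjTranspose_mul, Matrix.conjTranspose_conjTranspose]
  rw [h, Matrix.trace, Fintype.sum_sigma, star_sum]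
  refine Finset.sum_congr rfl fun k _ => ?_
  rw [Matrix.trace, Finset.mul_sum, star_sum]
  refine Finset.sum_congr rfl fun d _ => ?_
  rw [Matrix.diag_apply, Matrix.diag_apply, blockWeight, Matrix.blockDiagonal'_conjTranspose,
    Matrix.mul_blockDiagonal'_apply, Matrix.mul_apply, Finset.mul_sum, star_sum]
  refine Finset.sum_congr rfl fun e _ => ?_
  rw [received_apply]
  simp only [Matrix.conjTranspose_apply, Matrix.smul_apply, star_mul', smul_eq_mul,
    Complex.star_def, Complex.conj_ofReal, Complex.conj_conj]
  ring

/-- The part of the weighted sum-MSE objective that does not depend on the precoders. -/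
def baseValue (U : Receivers K N D) (W : Weights K D) : ℝ :=
  ∑ k, S.α k * ((W k).trace.re + (((S.σ k : ℂ) ^ 2) • (W k * ((U k)ᴴ * U k))).trace.re -
    Real.log (W k).det.re)

theorem trace_mul_mse (U : Receivers K N D) {W : Weights K D} (hW : ∀ k, (W k).IsHermitian)
    (P : Precoders M K D) (k : Fin K) :
    (W k * S.mse U P k).trace.re = (W k).trace.re +
        (((S.σ k : ℂ) ^ 2) • (W k * ((U k)ᴴ * U k))).trace.re +
      (∑ j, (W k * ((U k)ᴴ * S.H k * P j) * ((U k)ᴴ * S.H k * P j)ᴴ).trace).re -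
      2 * (W k * ((U k)ᴴ * S.H k * P k)).trace.re := by
  set V := fun j => (U k)ᴴ * S.H k * P j with hV
  have h1 : S.mse U P k = 1 - V k - (V k)ᴴ + ∑ j, V j * (V j)ᴴ +
      ((S.σ k : ℂ) ^ 2) • ((U k)ᴴ * U k) := by
    have h2 : (U k)ᴴ * S.interf P k * U k = ∑ j ∈ Finset.univ.erase k, V j * (V j)ᴴ +
        ((S.σ k : ℂ) ^ 2) • ((U k)ᴴ * U k) := by
      rw [interf, Matrix.mul_add, Matrix.add_mul, Matrix.mul_sum, Matrix.sum_mul,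
        Matrix.mul_smul, Matrix.smul_mul, Matrix.mul_one]
      congr 1
      refine Finset.sum_congr rfl fun j _ => ?_
      simp only [hV, Matrix.conjTranspose_mul, Matrix.conjTranspose_conjTranspose,
        Matrix.mul_assoc]
    rw [← Finset.sum_erase_add _ _ (Finset.mem_univ k), mse, h2]
    change (1 - V k) * (1 - V k)ᴴ + _ = _
    rw [Matrix.conjTranspose_sub, Matrix.conjTranspose_one]
    noncomm_ring
  have h3 : (W k * (V k)ᴴ).trace.re = (W k * V k).trace.re := by
    have : W k * (V k)ᴴ = (V k * W k)ᴴ := by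
      rw [Matrix.conjTranspose_mul (V k) (W k), (hW k).eq]
    rw [this, Matrix.trace_conjTranspose, Matrix.trace_mul_comm]
    simp
  change _ = _ + (∑ j, (W k * V j * (V j)ᴴ).trace).re - 2 * (W k * V k).trace.re
  rw [h1]
  clear_value V
  simp only [Matrix.mul_add, Matrix.mul_sub, Matrix.mul_one, Matrix.mul_sum, Matrix.trace_add,
    Matrix.trace_sub, Matrix.trace_sum, Matrix.mul_smul, Complex.add_re, Complex.sub_re, h3,
    Matrix.mul_assoc]
  ring

/-- The precoders enter only through `received`, which is linear in the rows, so every statement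
about rows reduces to `quadFun`. -/
theorem wmmse_ofRows (U : Receivers K N D) {W : Weights K D} (hW : ∀ k, (W k).IsHermitian)
    (p : Fin M → (Σ k, Fin (D k)) → ℂ) :
    S.wmmse (U, W, ofRows p) =
      S.baseValue U W + Matrix.quadFun (S.blockWeight W) (S.received U p) := by
  rw [Matrix.quadFun, trace_received_mul, trace_mul_received, Complex.re_sum, Complex.re_sum,
    baseValue, wmmse, Finset.mul_sum, ← Finset.sum_sub_distrib, ← Finset.sum_add_distrib]
  refine Finset.sum_congr rfl fun k _ => ?_
  rw [Complex.re_ofReal_mul, Complex.re_ofReal_mul, S.trace_mul_mse U hW]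
  ring

theorem blockWeight_posSemidef {W : Weights K D} (hW : ∀ k, (W k).PosSemidef) :
    (S.blockWeight W).PosSemidef := by
  choose B hB using fun k => ((hW k).smul (a := (S.α k : ℂ))
    (by exact_mod_cast S.α_nonneg k)).exists_conjTranspose_mul_self
  have : S.blockWeight W = (Matrix.blockDiagonal' B)ᴴ * Matrix.blockDiagonal' B := by
    rw [Matrix.blockDiagonal'_conjTranspose, ← Matrix.blockDiagonal'_mul, blockWeight]
    congr 1
    exact funext hB
  rw [this]
  exact Matrix.posSemidef_conjTranspose_mul_self _

/-! ### Equivalent precoders -/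

theorem received_sub_mul_eq_zero (U : Receivers K N D) {W : Weights K D}
    (hW : ∀ k, (W k).PosSemidef) {p q : Fin M → (Σ k, Fin (D k)) → ℂ}
    (h1 : S.wmmse (U, W, ofRows q) = S.wmmse (U, W, ofRows p))
    (h2 : S.wmmse (U, W, ofRows p) ≤ S.wmmse (U, W, ofRows (p + (2⁻¹ : ℝ) • (q - p)))) :
    S.received U (q - p) * S.blockWeight W = 0 := by
  have hq : q = p + (q - p) := by abel
  rw [hq] at h1
  simp only [S.wmmse_ofRows U fun k => (hW k).1, received_add, received_smul] at h1 h2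
  exact (S.blockWeight_posSemidef hW).mul_eq_zero_of_quadFun (add_left_cancel h1)
    (le_of_add_le_add_left h2)

/-- Kernel directions are invisible from every base point p, not just where they were found. This
replaces uniqueness of the row minimizers. -/
theorem wmmse_add_of_received_mul_eq_zero (U : Receivers K N D) {W : Weights K D}
    (hW : ∀ k, (W k).PosSemidef) {z : Fin M → (Σ k, Fin (D k)) → ℂ}
    (hz : S.received U z * S.blockWeight W = 0) (p : Fin M → (Σ k, Fin (D k)) → ℂ) :
    S.wmmse (U, W, ofRows (p + z)) = S.wmmse (U, W, ofRows p) := by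
  simp only [S.wmmse_ofRows U fun k => (hW k).1, received_add]
  rw [Matrix.quadFun_add_of_mul_eq_zero (S.blockWeight_posSemidef hW).1 _ hz]

end PAPC.System

namespace PAPC.System

variable {M K : ℕ} {N D : Fin K → ℕ} (S : System M K N D)

/-! ### One pass of the loop over the antennas -/

theorem matA_eq (U : Receivers K N D) (W : Weights K D) :
    S.matA U W = Matrix.blockDiagonal' U * S.blockWeight W * (Matrix.blockDiagonal' U)ᴴ := by
  rw [Matrix.blockDiagonal'_conjTranspose, blockWeight, ← Matrix.blockDiagonal'_mul,
    ← Matrix.blockDiagonal'_mul, matA]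
  simp only [Matrix.mul_smul, Matrix.smul_mul]

theorem matB_eq (U : Receivers K N D) (W : Weights K D) :
    S.matB U W = S.blockWeight W * (Matrix.blockDiagonal' U)ᴴ := by
  rw [Matrix.blockDiagonal'_conjTranspose, blockWeight, ← Matrix.blockDiagonal'_mul, matB]
  simp only [Matrix.smul_mul]

theorem matA_posSemidef (U : Receivers K N D) {W : Weights K D}
    (hW : ∀ k, (W k).PosSemidef) : (S.matA U W).PosSemidef := by
  rw [matA_eq]
  exact (S.blockWeight_posSemidef hW).mul_mul_conjTranspose_same _

theorem scalA_nonneg (U : Receivers K N D) {W : Weights K D}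
    (hW : ∀ k, (W k).PosSemidef) (m : Fin M) : 0 ≤ S.scalA (S.matA U W) m :=
  (Complex.nonneg_iff.1 ((S.matA_posSemidef U hW).dotProduct_mulVec_nonneg _)).1

/-- With v = blkdiag(U_k)ᴴ h_m and Ω = `blockWeight`, a_m = vᴴ Ω v; its vanishing gives Ω v = 0, a
factor of both products. Hence b_m = 0 whenever a_m = 0. -/
theorem mulVec_eq_zero_of_scalA_eq_zero (U : Receivers K N D) {W : Weights K D}
    (hW : ∀ k, (W k).PosSemidef) {m : Fin M} (h : S.scalA (S.matA U W) m = 0) :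
    S.matA U W *ᵥ S.col m = 0 ∧ S.matB U W *ᵥ S.col m = 0 := by
  have h0 : star (S.col m) ⬝ᵥ (S.matA U W *ᵥ S.col m) = 0 :=
    Complex.ext h (Complex.nonneg_iff.1
      ((S.matA_posSemidef U hW).dotProduct_mulVec_nonneg (S.col m))).2.symm
  refine ⟨((S.matA_posSemidef U hW).dotProduct_mulVec_zero_iff _).1 h0, ?_⟩
  rw [matA_eq, ← Matrix.mulVec_mulVec, ← Matrix.mulVec_mulVec, Matrix.dotProduct_mulVec] at h0
  have h1 : star (S.col m) ᵥ* Matrix.blockDiagonal' U =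
      star ((Matrix.blockDiagonal' U)ᴴ *ᵥ S.col m) := by
    rw [Matrix.star_mulVec, Matrix.conjTranspose_conjTranspose]
  rw [h1, (S.blockWeight_posSemidef hW).dotProduct_mulVec_zero_iff] at h0
  rw [matB_eq, ← Matrix.mulVec_mulVec, h0]

/-- The matrix `C` without the contribution of antenna `m`. -/
def deflated (m : Fin M) (s : LoopState M K N D) :
    Matrix (Σ k, Fin (D k)) (Σ k, Fin (N k)) ℂ :=
  s.2 - Matrix.vecMulVec (s.1 m) (star (S.col m))

/-- The vector `b_m`. -/
def linTerm (U : Receivers K N D) (W : Weights K D) (m : Fin M) (s : LoopState M K N D) :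
    (Σ k, Fin (D k)) → ℂ :=
  -(S.matB U W *ᵥ S.col m) + S.deflated m s *ᵥ (S.matA U W *ᵥ S.col m)

/-- The new value of the vector `p_m`. -/
def newRow (U : Receivers K N D) (W : Weights K D) (m : Fin M) (s : LoopState M K N D) :
    (Σ k, Fin (D k)) → ℂ :=
  -((min (1 / S.scalA (S.matA U W) m)
    (√(S.Pow m) / ‖WithLp.toLp 2 (S.linTerm U W m s)‖) : ℝ) : ℂ) • S.linTerm U W m s

theorem antennaStep_eq (U : Receivers K N D) (W : Weights K D) (m : Fin M)
    (s : LoopState M K N D) : S.antennaStep U W m s =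
      (Function.update s.1 m (S.newRow U W m s),
        S.deflated m s + Matrix.vecMulVec (S.newRow U W m s) (star (S.col m))) := rfl

theorem stack_update {m : Fin M} {s : LoopState M K N D} (hs : s.2 = S.stack s.1)
    (q : (Σ k, Fin (D k)) → ℂ) :
    S.stack (Function.update s.1 m q) =
      S.deflated m s + Matrix.vecMulVec q (star (S.col m)) := by
  rw [deflated, hs, stack, stack, ← Finset.sum_erase_add _ _ (Finset.mem_univ m),
    ← Finset.sum_erase_add Finset.univ (fun l => Matrix.vecMulVec (s.1 l) (star (S.col l)))
      (Finset.mem_univ m), add_sub_cancel_right, Function.update_self]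
  congr 1
  refine Finset.sum_congr rfl fun l hl => ?_
  rw [Function.update_of_ne (Finset.ne_of_mem_erase hl)]

theorem antennaStep_snd {U : Receivers K N D} {W : Weights K D} {m : Fin M}
    {s : LoopState M K N D} (hs : s.2 = S.stack s.1) :
    (S.antennaStep U W m s).2 = S.stack (S.antennaStep U W m s).1 := by
  rw [antennaStep_eq, S.stack_update hs]

/-- A new row q adds the rank-one term q vᴴ, v = blkdiag(U_k)ᴴ h_m, to the deflated `received`
matrix. In `quadFun_add` its quadratic part is a_m ‖q‖² and its linear part pairs q with b_m. -/
theorem wmmse_update_row (U : Receivers K N D) {W : Weights K D}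
    (hW : ∀ k, (W k).PosSemidef) {m : Fin M} {s : LoopState M K N D}
    (hs : s.2 = S.stack s.1) (q : (Σ k, Fin (D k)) → ℂ) :
    S.wmmse (U, W, ofRows (Function.update s.1 m q)) =
      S.baseValue U W + Matrix.quadFun (S.blockWeight W)
        (S.deflated m s * Matrix.blockDiagonal' U) +
      (S.scalA (S.matA U W) m * ‖WithLp.toLp 2 q‖ ^ 2 +
        2 * (inner ℂ (WithLp.toLp 2 q) (WithLp.toLp 2 (S.linTerm U W m s))).re) := by
  have hA := S.matA_posSemidef U hW
  set Ub := Matrix.blockDiagonal' U with hUb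
  set v := Ubᴴ *ᵥ S.col m with hv
  set Ω := S.blockWeight W with hΩ
  have hZ : Matrix.vecMulVec q (star (S.col m)) * Ub = Matrix.vecMulVec q (star v) := by
    rw [Matrix.vecMulVec_mul, hv, Matrix.star_mulVec, Matrix.conjTranspose_conjTranspose]
  have hAv : S.matA U W *ᵥ S.col m = Ub *ᵥ (Ω *ᵥ v) := by
    rw [matA_eq, ← Matrix.mulVec_mulVec, ← Matrix.mulVec_mulVec]
  have hBv : S.matB U W *ᵥ S.col m = Ω *ᵥ v := by
    rw [matB_eq, ← Matrix.mulVec_mulVec]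
  have hZc : (Matrix.vecMulVec q (star v))ᴴ = Matrix.vecMulVec v (star q) := by
    rw [Matrix.conjTranspose_vecMulVec, star_star]
  have ha : star v ⬝ᵥ (Ω *ᵥ v) = (S.scalA (S.matA U W) m : ℂ) := by
    have h0 : star v ⬝ᵥ (Ω *ᵥ v) = star (S.col m) ⬝ᵥ (S.matA U W *ᵥ S.col m) := by
      rw [hAv, Matrix.dotProduct_mulVec (star (S.col m)) Ub, hv, Matrix.star_mulVec,
        Matrix.conjTranspose_conjTranspose]
    rw [h0]
    exact Complex.ext rfl (Complex.nonneg_iff.1 (hA.dotProduct_mulVec_nonneg _)).2.symm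
  have h1 : (Matrix.vecMulVec q (star v) * Ω * (Matrix.vecMulVec q (star v))ᴴ).trace.re =
      S.scalA (S.matA U W) m * ‖WithLp.toLp 2 q‖ ^ 2 := by
    rw [hZc, Matrix.mul_assoc, Matrix.mul_vecMulVec, Matrix.vecMulVec_mul_vecMulVec,
      Matrix.trace_vecMulVec, ha]
    have h2 : q ⬝ᵥ star q = ((‖WithLp.toLp 2 q‖ ^ 2 : ℝ) : ℂ) := by
      have := inner_self_eq_norm_sq_to_K (𝕜 := ℂ) (WithLp.toLp 2 q)
      rw [EuclideanSpace.inner_eq_star_dotProduct] at this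
      simpa using this
    simp only [dotProduct_smul, h2, smul_eq_mul, ← Complex.ofReal_mul,
      Complex.ofReal_re]
  have h2 : ((S.deflated m s * Ub * Ω - Ω) * (Matrix.vecMulVec q (star v))ᴴ).trace.re =
      (inner ℂ (WithLp.toLp 2 q) (WithLp.toLp 2 (S.linTerm U W m s))).re := by
    rw [hZc, Matrix.mul_vecMulVec, Matrix.trace_vecMulVec,
      EuclideanSpace.inner_eq_star_dotProduct]
    simp only [linTerm, hAv, hBv, Matrix.sub_mulVec, Matrix.mulVec_mulVec, Matrix.mul_assoc]
    rw [neg_add_eq_sub]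
  rw [S.wmmse_ofRows U fun k => (hW k).1, received, S.stack_update hs, Matrix.add_mul, hZ,
    Matrix.quadFun_add (S.blockWeight_posSemidef hW).1, h1, h2]
  ring

theorem linTerm_eq_zero (U : Receivers K N D) {W : Weights K D}
    (hW : ∀ k, (W k).PosSemidef) {m : Fin M} (s : LoopState M K N D)
    (h : S.scalA (S.matA U W) m = 0) : S.linTerm U W m s = 0 := by
  obtain ⟨h1, h2⟩ := S.mulVec_eq_zero_of_scalA_eq_zero U hW h
  rw [linTerm, h1, h2, Matrix.mulVec_zero, neg_zero, add_zero]

theorem norm_newRow_le (U : Receivers K N D) {W : Weights K D}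
    (hW : ∀ k, (W k).PosSemidef) (m : Fin M) (s : LoopState M K N D) :
    ‖WithLp.toLp 2 (S.newRow U W m s)‖ ≤ √(S.Pow m) :=
  norm_neg_min_smul_le (S.scalA_nonneg U hW m) (Real.sqrt_nonneg _)
    (WithLp.toLp 2 (S.linTerm U W m s))

theorem wmmse_newRow_le (U : Receivers K N D) {W : Weights K D}
    (hW : ∀ k, (W k).PosSemidef) {m : Fin M} {s : LoopState M K N D}
    (hs : s.2 = S.stack s.1) {q : (Σ k, Fin (D k)) → ℂ} (hq : ‖WithLp.toLp 2 q‖ ≤ √(S.Pow m)) :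
    S.wmmse (U, W, ofRows (Function.update s.1 m (S.newRow U W m s))) ≤
      S.wmmse (U, W, ofRows (Function.update s.1 m q)) := by
  rw [S.wmmse_update_row U hW hs, S.wmmse_update_row U hW hs]
  refine add_le_add_right (neg_min_smul_isMin (S.scalA_nonneg U hW m) (Real.sqrt_nonneg _)
    (fun h => ?_) hq) _
  rw [S.linTerm_eq_zero U hW s h, WithLp.toLp_zero]

/-! ### The loop over the antennas -/

/-- The rows of the precoders after the first `n` passes of the loop over the antennas. -/
def loopRows (U : Receivers K N D) (W : Weights K D) (P : Precoders M K D) (n : ℕ) :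
    Fin M → (Σ k, Fin (D k)) → ℂ :=
  (S.antennaLoop U W P n).1

theorem antennaLoop_succ (U : Receivers K N D) (W : Weights K D) (P : Precoders M K D)
    {n : ℕ} (h : n < M) :
    S.antennaLoop U W P (n + 1) = S.antennaStep U W ⟨n, h⟩ (S.antennaLoop U W P n) := by
  rw [antennaLoop, dif_pos h]

theorem antennaLoop_snd (U : Receivers K N D) (W : Weights K D) (P : Precoders M K D)
    (n : ℕ) : (S.antennaLoop U W P n).2 = S.stack (S.antennaLoop U W P n).1 := by
  induction n with
  | zero => rfl
  | succ n ih =>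
    by_cases h : n < M
    · rw [antennaLoop_succ _ _ _ _ h]
      exact S.antennaStep_snd ih
    · rwa [antennaLoop, dif_neg h]

theorem loopRows_zero (U : Receivers K N D) (W : Weights K D) (P : Precoders M K D) :
    S.loopRows U W P 0 = row P := rfl

theorem loopRows_succ (U : Receivers K N D) (W : Weights K D) (P : Precoders M K D)
    {n : ℕ} (h : n < M) : S.loopRows U W P (n + 1) = Function.update (S.loopRows U W P n) ⟨n, h⟩
      (S.newRow U W ⟨n, h⟩ (S.antennaLoop U W P n)) := by
  rw [loopRows, antennaLoop_succ _ _ _ _ h]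
  rfl

theorem loopRows_succ_apply_of_ne (U : Receivers K N D) (W : Weights K D)
    (P : Precoders M K D) {n : ℕ} {m : Fin M} (hm : (m : ℕ) ≠ n) :
    S.loopRows U W P (n + 1) m = S.loopRows U W P n m := by
  by_cases h : n < M
  · rw [loopRows_succ _ _ _ _ h, Function.update_of_ne]
    exact fun hmn => hm (congrArg Fin.val hmn)
  · rw [loopRows, antennaLoop, dif_neg h]
    rfl

theorem row_updateP (U : Receivers K N D) (W : Weights K D) (P : Precoders M K D) :
    row (S.updateP U W P) = S.loopRows U W P M :=
  row_ofRows _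

theorem norm_loopRows_le (U : Receivers K N D) {W : Weights K D}
    (hW : ∀ k, (W k).PosSemidef) {P : Precoders M K D} (hP : P ∈ S.feasibleP) (n : ℕ)
    (m : Fin M) : ‖WithLp.toLp 2 (S.loopRows U W P n m)‖ ≤ √(S.Pow m) := by
  induction n with
  | zero => exact (S.mem_feasibleP_iff P).1 hP m
  | succ n ih =>
    by_cases hm : (m : ℕ) = n
    · subst hm
      rw [loopRows_succ _ _ _ _ m.2, Function.update_self]
      exact S.norm_newRow_le U hW _ _
    · rwa [loopRows_succ_apply_of_ne _ _ _ _ hm]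

theorem updateP_mem_feasibleP (U : Receivers K N D) {W : Weights K D}
    (hW : ∀ k, (W k).PosSemidef) {P : Precoders M K D} (hP : P ∈ S.feasibleP) :
    S.updateP U W P ∈ S.feasibleP := by
  rw [mem_feasibleP_iff, row_updateP]
  exact S.norm_loopRows_le U hW hP M

theorem wmmse_loopRows_succ_le (U : Receivers K N D) {W : Weights K D}
    (hW : ∀ k, (W k).PosSemidef) (P : Precoders M K D) (m : Fin M)
    {q : (Σ k, Fin (D k)) → ℂ} (hq : ‖WithLp.toLp 2 q‖ ≤ √(S.Pow m)) :
    S.wmmse (U, W, ofRows (S.loopRows U W P (m + 1))) ≤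
      S.wmmse (U, W, ofRows (Function.update (S.loopRows U W P m) m q)) := by
  rw [loopRows_succ _ _ _ _ m.2]
  exact S.wmmse_newRow_le U hW (S.antennaLoop_snd U W P m) hq

theorem wmmse_loopRows_antitone (U : Receivers K N D) {W : Weights K D}
    (hW : ∀ k, (W k).PosSemidef) {P : Precoders M K D} (hP : P ∈ S.feasibleP) :
    Antitone fun n => S.wmmse (U, W, ofRows (S.loopRows U W P n)) := by
  refine antitone_nat_of_succ_le fun n => ?_
  by_cases h : n < M
  -- The old row is itself an admissible competitor.
  · have := S.wmmse_loopRows_succ_le U hW P ⟨n, h⟩ (S.norm_loopRows_le U hW hP n ⟨n, h⟩)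
    rwa [Function.update_eq_self] at this
  · rw [loopRows, loopRows, antennaLoop, dif_neg h]

end PAPC.System

/-- An antitone real sequence converges or tends to -∞, and a finite limit along F excludes the
latter; no lower bound on the objective is needed. -/
theorem Antitone.tendsto_atTop_of_tendsto {u : ℕ → ℝ} (hu : Antitone u) {F : Filter ℕ} [F.NeBot]
    (hF : F ≤ atTop) {l : ℝ} (h : Tendsto u F (𝓝 l)) : Tendsto u atTop (𝓝 l) := by
  rcases tendsto_atTop_of_antitone hu with h' | ⟨l', h'⟩
  · exact absurd h (not_tendsto_nhds_of_tendsto_atBot (h'.mono_left hF) l)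
  · rwa [tendsto_nhds_unique h (h'.mono_left hF)]

namespace PAPC.System

variable {M K : ℕ} {N D : Fin K → ℕ} (S : System M K N D)

/-! ### Feasible sets of rows -/

/-- The families of rows that obey the power constraints. -/
def feasibleRows : Set (Fin M → (Σ k, Fin (D k)) → ℂ) :=
  {p | ∀ m, ‖WithLp.toLp 2 (p m)‖ ≤ √(S.Pow m)}

theorem isCompact_feasibleRows : IsCompact (S.feasibleRows (D := D)) := by
  have h : S.feasibleRows (D := D) = Set.univ.pi fun m =>
      (WithLp.ofLp '' Metric.closedBall (0 : EuclideanSpace ℂ (Σ k, Fin (D k))) √(S.Pow m)) := by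
    ext p
    simp only [feasibleRows, Set.mem_ofPred_eq, Set.mem_univ_pi]
    refine forall_congr' fun m => ⟨fun hm => ⟨WithLp.toLp 2 (p m), by simpa using hm, rfl⟩, ?_⟩
    rintro ⟨q, hq, hqp⟩
    rw [← hqp]
    simpa using hq
  rw [h]
  exact isCompact_univ_pi fun m =>
    (isCompact_closedBall _ _).image (PiLp.continuous_ofLp 2 _)

theorem continuous_ofRows :
    Continuous (ofRows : (Fin M → (Σ k, Fin (D k)) → ℂ) → Precoders M K D) := by
  unfold ofRows
  refine continuous_pi fun k => continuous_matrix fun m d => ?_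
  exact (continuous_apply_apply (ρ := fun _ _ => ℂ) m (⟨k, d⟩ : Σ k, Fin (D k))).star

theorem continuous_row :
    Continuous (row : Precoders M K D → Fin M → (Σ k, Fin (D k)) → ℂ) := by
  unfold row
  refine continuous_pi fun m => continuous_pi fun d => ?_
  exact ((continuous_apply d.1).matrix_elem m d.2).star

theorem continuousAt_optValue (P : Precoders M K D) : ContinuousAt S.optValue P :=
  continuousAt_const.sub (S.differentiableAt_wsr P).continuousAt

theorem continuous_channel_mul (k : Fin K) :
    Continuous fun P : Precoders M K D => S.H k * P k :=
  continuous_const.matrix_mul (continuous_apply k)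

theorem continuous_recvCov (k : Fin K) :
    Continuous fun P : Precoders M K D => S.recvCov P k := by
  unfold recvCov
  refine (continuous_finsetSum _ fun j _ => ?_).add continuous_const
  have h : Continuous fun P : Precoders M K D => P j := continuous_apply j
  exact ((continuous_const.matrix_mul h).matrix_mul h.matrix_conjTranspose).matrix_mul
    continuous_const

/-- Together with `continuous_weight_mul`, this puts the two updates in inverse-free form, as closed
equations that survive limits. -/
theorem continuous_recvCov_mul (k : Fin K) :
    Continuous fun z : Point M K N D => S.recvCov z.2.2 k * z.1 k :=
  ((S.continuous_recvCov k).comp (continuous_snd.comp continuous_snd)).matrix_mul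
    ((continuous_apply k).comp continuous_fst)

theorem continuous_weight_mul (k : Fin K) :
    Continuous fun z : Point M K N D => z.2.1 k * (1 - (z.1 k)ᴴ * S.H k * z.2.2 k) := by
  have hU : Continuous fun z : Point M K N D => z.1 k := (continuous_apply k).comp continuous_fst
  have hW : Continuous fun z : Point M K N D => z.2.1 k :=
    (continuous_apply k).comp (continuous_fst.comp continuous_snd)
  have hP : Continuous fun z : Point M K N D => z.2.2 k :=
    (continuous_apply k).comp (continuous_snd.comp continuous_snd)
  exact hW.matrix_mul (continuous_const.sub
    ((hU.matrix_conjTranspose.matrix_mul continuous_const).matrix_mul hP))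

/-! ### Sequences of iterates -/

variable {S}

theorem IsIterateSeq.posDef_and_feasible {x : ℕ → Point M K N D} (hx : S.IsIterateSeq x) (t : ℕ) :
    (∀ k, ((x t).2.1 k).PosDef) ∧ (x t).2.2 ∈ S.feasibleP := by
  induction t with
  | zero => exact ⟨fun k => by rw [hx.2.1 k]; exact Matrix.PosDef.one, hx.1⟩
  | succ t ih =>
    rw [hx.2.2 t]
    exact ⟨S.updateW_posDef _, S.updateP_mem_feasibleP _
      (fun k => (S.updateW_posDef _ k).posSemidef) ih.2⟩

theorem IsIterateSeq.wmmse_succ_le {x : ℕ → Point M K N D} (hx : S.IsIterateSeq x) (t : ℕ) :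
    S.wmmse (x (t + 1)) ≤ S.optValue (x t).2.2 := by
  have h := S.wmmse_loopRows_antitone (S.updateU (x t).2.2)
    (fun k => (S.updateW_posDef (x t).2.2 k).posSemidef) (hx.posDef_and_feasible t).2
    (Nat.zero_le M)
  simp only [loopRows_zero, ofRows_row, wmmse_update] at h
  rwa [hx.2.2 t]

theorem IsIterateSeq.optValue_le {x : ℕ → Point M K N D} (hx : S.IsIterateSeq x) (t : ℕ) :
    S.optValue (x t).2.2 ≤ S.wmmse (x t) :=
  S.optValue_le_wmmse _ _ _ (hx.posDef_and_feasible t).1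

/-- If all stages `Q 0, …, Q M` of a sweep over the rows give the same value and each stage is optimal for its row, then the last one is optimal
for all rows. -/
theorem rowwise_optimal_of_stages {U : Receivers K N D} {W : Weights K D}
    (hW : ∀ k, (W k).PosSemidef) {Q : ℕ → Fin M → (Σ k, Fin (D k)) → ℂ} {L : ℝ}
    (hfeas : ∀ n, Q n ∈ S.feasibleRows)
    (hval : ∀ n ≤ M, S.wmmse (U, W, ofRows (Q n)) = L)
    (hopt : ∀ (m : Fin M) q, ‖WithLp.toLp 2 q‖ ≤ √(S.Pow m) →
      L ≤ S.wmmse (U, W, ofRows (Function.update (Q m) m q)))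
    (hne : ∀ n (m : Fin M), (m : ℕ) ≠ n → Q (n + 1) m = Q n m)
    (m : Fin M) (q : (Σ k, Fin (D k)) → ℂ) (hq : ‖WithLp.toLp 2 q‖ ≤ √(S.Pow m)) :
    L ≤ S.wmmse (U, W, ofRows (Function.update (Q M) m q)) := by
  have hstep : ∀ m : Fin M,
      S.received U (Q (m + 1) - Q m) * S.blockWeight W = 0 := by
    intro m
    refine S.received_sub_mul_eq_zero U hW
      ((hval _ m.2).trans (hval _ m.2.le).symm) ?_
    -- The two stages differ in row m only, so their midpoint is a competitor for the optimality of
    -- stage m.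
    have hmid : Q m + (2⁻¹ : ℝ) • (Q (m + 1) - Q m) =
        Function.update (Q m) m ((2⁻¹ : ℝ) • Q (m + 1) m + (2⁻¹ : ℝ) • Q m m) := by
      ext i d
      rcases eq_or_ne i m with rfl | h
      · simp
        ring
      · simp [h, hne m i (fun h' => h (Fin.ext h'))]
    rw [hmid, hval _ m.2.le]
    refine hopt m _ ?_
    have h1 := hfeas (m + 1) m
    have h2 := hfeas m m
    rw [WithLp.toLp_add, WithLp.toLp_smul, WithLp.toLp_smul]
    refine (norm_add_le _ _).trans ?_
    rw [norm_smul, norm_smul]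
    norm_num
    linarith
  -- Kernel directions telescope, and row m is not touched again after its own pass.
  have hdiff : ∀ n, (m : ℕ) + 1 ≤ n → n ≤ M →
      S.received U (Q n - Q (m + 1)) * S.blockWeight W = 0 ∧ Q n m = Q (m + 1) m := by
    intro n hn
    induction n, hn using Nat.le_induction with
    | base => simp [received, stack]
    | succ n hn ih =>
      intro hnM
      obtain ⟨ih1, ih2⟩ := ih (by omega)
      refine ⟨?_, (hne n m (by omega)).trans ih2⟩
      have : Q (n + 1) - Q (m + 1) = (Q (n + 1) - Q n) + (Q n - Q (m + 1)) := by abel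
      rw [this, received_add, Matrix.add_mul, ih1, hstep ⟨n, hnM⟩, add_zero]
  obtain ⟨hz, hzm⟩ := hdiff M m.2 le_rfl
  have hsplit : Function.update (Q M) m q =
      Function.update (Q m) m q + (Q M - Q (m + 1)) := by
    ext i d
    rcases eq_or_ne i m with rfl | h
    · simp [hzm]
    · simp [h, hne m i (fun h' => h (Fin.ext h'))]
  rw [hsplit, S.wmmse_add_of_received_mul_eq_zero U hW hz]
  exact hopt m q hq

theorem IsIterateSeq.isStationary {x : ℕ → Point M K N D} (hx : S.IsIterateSeq x)
    {xs : Point M K N D} (hxs : MapClusterPt xs atTop x) :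
    IsStationaryMin S.wmmse S.feasible xs ∧ IsStationaryMax S.wsr S.feasibleP xs.2.2 := by
  -- An ultrafilter makes all compactly confined stages converge at once, without extracting
  -- successive subsequences.
  obtain ⟨F, hF, hxF⟩ := mapClusterPt_iff_ultrafilter.1 hxs
  have hpos := fun t => (hx.posDef_and_feasible t).1
  have hfeas := fun t => (hx.posDef_and_feasible t).2
  have hF1 : ∀ᶠ t in (F : Filter ℕ), 1 ≤ t := hF (eventually_ge_atTop 1)
  have hstep : ∀ t, 1 ≤ t → x t = S.step (x (t - 1)) := fun t ht => by
    rw [← hx.2.2, Nat.sub_add_cancel ht]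
  have hUF : Tendsto (fun t => (x t).1) F (𝓝 xs.1) := (continuous_fst.tendsto xs).comp hxF
  have hWF : Tendsto (fun t => (x t).2.1) F (𝓝 xs.2.1) :=
    ((continuous_fst.comp continuous_snd).tendsto xs).comp hxF
  have hPF : Tendsto (fun t => (x t).2.2) F (𝓝 xs.2.2) :=
    ((continuous_snd.comp continuous_snd).tendsto xs).comp hxF
  -- limits of the stages of the sweep over the rows
  set R : ℕ → ℕ → Fin M → (Σ k, Fin (D k)) → ℂ :=
    fun n t => S.loopRows (x t).1 (x t).2.1 (x (t - 1)).2.2 n with hR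
  have hRfeas : ∀ n t, R n t ∈ S.feasibleRows := fun n t =>
    S.norm_loopRows_le _ (fun k => (hpos t k).posSemidef) (hfeas _) n
  have hlim : ∀ n, ∃ q ∈ S.feasibleRows, Tendsto (R n) F (𝓝 q) := fun n =>
    S.isCompact_feasibleRows.ultrafilter_le_nhds (F.map (R n)) (le_principal_iff.2
      (mem_map.2 (Filter.Eventually.of_forall (hRfeas n))))
  choose Q hQfeas hQ using hlim
  have hprev : Tendsto (fun t => (x (t - 1)).2.2) F (𝓝 (ofRows (Q 0))) := by
    have := (continuous_ofRows.tendsto (Q 0)).comp (hQ 0)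
    refine this.congr fun t => ?_
    simp only [hR, Function.comp, loopRows_zero, ofRows_row]
  -- the limits of the receivers and of the weights
  have hzF : Tendsto (fun t => ((x t).1, (x t).2.1, (x (t - 1)).2.2)) F
      (𝓝 (xs.1, xs.2.1, ofRows (Q 0))) := hUF.prodMk_nhds (hWF.prodMk_nhds hprev)
  -- The limiting receivers come from the limit `Q 0` of the previous precoders, which need not be
  -- `xs.2.2`.
  have hUs : xs.1 = S.updateU (ofRows (Q 0)) := by
    funext k
    have h := tendsto_nhds_unique_of_eventuallyEq
      (((S.continuous_recvCov_mul k).tendsto _).comp hzF)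
      (((S.continuous_channel_mul k).tendsto _).comp hprev) (hF1.mono fun t ht => by
        simp only [Function.comp, hstep t ht, step, updateU]
        rw [Matrix.mul_nonsing_inv_cancel_left _ _ (S.isUnit_det_recvCov _ k)])
    rw [updateU, ← h, Matrix.nonsing_inv_mul_cancel_left _ _ (S.isUnit_det_recvCov _ k)]
  have hWs : xs.2.1 = S.updateW xs.1 (ofRows (Q 0)) := by
    funext k
    have h := tendsto_nhds_unique_of_eventuallyEq
      (((S.continuous_weight_mul k).tendsto _).comp hzF)
      (tendsto_const_nhds (x := (1 : Matrix (Fin (D k)) (Fin (D k)) ℂ))) (hF1.mono fun t ht => by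
        simp only [Function.comp, hstep t ht, step, updateW, one_sub_updateU]
        exact Matrix.nonsing_inv_mul _
          ((Matrix.isUnit_iff_isUnit_det _).1 (S.mmse_posDef _ k).isUnit))
    exact (Matrix.inv_eq_left_inv h).symm
  have hWpos : ∀ k, (xs.2.1 k).PosDef := fun k => by
    rw [hWs, hUs]
    exact S.updateW_posDef _ k
  -- all values of the objective have the same limit
  have hu : Antitone fun t => S.wmmse (x t) :=
    antitone_nat_of_succ_le fun t => (hx.wmmse_succ_le t).trans (hx.optValue_le t)
  have huF : Tendsto (fun t => S.wmmse (x t)) F (𝓝 (S.wmmse xs)) :=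
    (S.differentiableAt_wmmse xs hWpos).continuousAt.tendsto.comp hxF
  have hutop := hu.tendsto_atTop_of_tendsto hF huF
  have hopt : Tendsto (fun t => S.optValue (x t).2.2) atTop (𝓝 (S.wmmse xs)) :=
    tendsto_of_tendsto_of_tendsto_of_le_of_le (hutop.comp (tendsto_add_atTop_nat 1)) hutop
      (fun t => hx.wmmse_succ_le t) (fun t => hx.optValue_le t)
  -- Thus `xs.1` and `xs.2.1` are optimal for `xs.2.2` too, although computed from `Q 0`.
  have hoptxs : S.wmmse xs = S.optValue xs.2.2 :=
    tendsto_nhds_unique (hopt.mono_left hF) ((S.continuousAt_optValue _).tendsto.comp hPF)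
  have hcont : ∀ {p : ℕ → Fin M → (Σ k, Fin (D k)) → ℂ} {q}, Tendsto p F (𝓝 q) →
      Tendsto (fun t => S.wmmse ((x t).1, (x t).2.1, ofRows (p t))) F
        (𝓝 (S.wmmse (xs.1, xs.2.1, ofRows q))) := fun {p q} hp =>
    (S.differentiableAt_wmmse (xs.1, xs.2.1, ofRows q) hWpos).continuousAt.tendsto.comp
      (hUF.prodMk_nhds (hWF.prodMk_nhds ((continuous_ofRows.tendsto q).comp hp)))
  have hlast : ∀ t, 1 ≤ t → row (x t).2.2 = R M t := fun t ht => by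
    simp only [hR, hstep t ht, step, row_updateP]
  have hval : ∀ n ≤ M, S.wmmse (xs.1, xs.2.1, ofRows (Q n)) = S.wmmse xs := fun n hn => by
    refine tendsto_nhds_unique (hcont (hQ n)) ?_
    -- Stage values lie between the value of stage M, `wmmse (x t)`, and that of stage 0, `optValue`
    -- of the previous precoder; both have the same limit.
    refine tendsto_of_tendsto_of_tendsto_of_le_of_le' huF
      ((hopt.comp (tendsto_sub_atTop_nat 1)).mono_left hF) (hF1.mono fun t ht => ?_)
      (hF1.mono fun t ht => ?_)
    · have h := S.wmmse_loopRows_antitone (x t).1 (fun k => (hpos t k).posSemidef)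
        (hfeas (t - 1)) hn
      have h' : ofRows (S.loopRows (x t).1 (x t).2.1 (x (t - 1)).2.2 M) = (x t).2.2 := by
        rw [← ofRows_row (x t).2.2, hlast t ht]
      simp only [h'] at h
      exact h
    · have h := S.wmmse_loopRows_antitone (x t).1 (fun k => (hpos t k).posSemidef)
        (hfeas (t - 1)) (Nat.zero_le n)
      simp only [loopRows_zero, ofRows_row] at h
      refine h.trans (le_of_eq ?_)
      simp only [hstep t ht, step]
      exact S.wmmse_update _
  have hrowxs : Q M = row xs.2.2 :=
    tendsto_nhds_unique_of_eventuallyEq (hQ M) ((continuous_row.tendsto xs.2.2).comp hPF)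
      (hF1.mono fun t ht => (hlast t ht).symm)
  refine S.isStationary_of_blockwise hWpos ?_ hoptxs fun m q hq => ?_
  · rw [mem_feasibleP_iff, ← hrowxs]
    exact hQfeas M
  rw [← hrowxs]
  refine rowwise_optimal_of_stages (fun k => (hWpos k).posSemidef) hQfeas hval
    (fun m q hq => ?_) (fun n m hm => ?_) m q hq
  · rw [← hval _ m.2]
    -- Only the optimality inequality passes to the limit, so `newRow` need not be continuous where
    -- `scalA` vanishes.
    refine le_of_tendsto_of_tendsto' (hcont (hQ (m + 1)))
      (hcont ((hQ m).update m tendsto_const_nhds)) fun t => ?_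
    exact S.wmmse_loopRows_succ_le (x t).1 (fun k => (hpos t k).posSemidef) _ m hq
  · refine tendsto_nhds_unique (tendsto_pi_nhds.1 (hQ (n + 1)) m)
      ((tendsto_pi_nhds.1 (hQ n) m).congr fun t => ?_)
    exact (S.loopRows_succ_apply_of_ne _ _ _ hm).symm

end PAPC.System

end

theorem theorem3 {M K : ℕ} {N D : Fin K → ℕ} (S : PAPC.System M K N D)
    (x : ℕ → PAPC.Point M K N D) (hx : S.IsIterateSeq x)
    (xs : PAPC.Point M K N D) (hxs : MapClusterPt xs Filter.atTop x) :
    PAPC.IsStationaryMin S.wmmse S.feasible xs ∧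
      PAPC.IsStationaryMax S.wsr S.feasibleP xs.2.2 := by
  exact hx.isStationary hxs
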